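/- **Conventions.** Fix an integer $k\ge 2$. Let $S_{12}^k$ be the clone of Boolean operations generated by the threshold function $Th_k^{k+1}$ (equal to $1$ iff at least $k$ of its $k+1$ arguments are $1$) and by $x\wedge(y\to z)$. For a set $\mathcal S\subseteq\{0,1\}^n$, let $Cl_{S_{12}^k}(\mathcal S)$ be the smallest set of vectors that contains $\mathcal S$ and is closed under the coordinatewise action of the operations of $S_{12}^k$. Vectors are ordered coordinatewise, and $\mathrm{Max}$ denotes the set of maximal elements; $\chi_T$ is the characteristic vector of $T\subseteq[n]$. The dimension of a hypergraph is the size of its largest hyperedge; a set of vertices is independent if it contains no hyperedge. $\mathcal H_k(\mathcal S)$ is the hypergraph with vertex set $[n]$ whose hyperedges are the sets $I\subseteq[n]$ with $|I|\le k$ such that no $u\in\mathcal S$ has $u_i=1$ for all $i\in I$. An enumeration problem is a function $A:\Sigma^*\to\mathcal P(\Sigma^*)$, with $\Sigma$ a finite alphabet. Algorithms run on random access machines with addition, subtraction, multiplication and an output instruction, time being measured by logarithmic cost. $A$ is in $\mathsf{DelayP}$ if some machine, on each input $w$, outputs each element of $A(w)$ exactly once and halts, and the time before the first output, between consecutive outputs,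 and after the last output is at most polynomial in $|w|$. A polynomial delay reduction from $A$ to $B$ consists of a polynomial time function $f$ and a problem $C\in\mathsf{DelayP}$ such that for every $x$: $C(xy)\cap C(xz)=\emptyset$ for distinct $y,z\in B(f(x))$, and $A(x)=\bigcup_{y\in B(f(x))}C(xy)$. Two problems are equivalent if each has a polynomial delay reduction to the other. $\textsc{EnumClosureMax}_{S_{12}^k}$: given a set $\mathcal S$ of Boolean vectors of the same size $n$ (listed), enumerate the maximal elements of $Cl_{S_{12}^k}(\mathcal S)\setminus\{\mathbf 0,\mathbf 1\}$. $\textsc{EnumKMaxIndSet}$: given a hypergraph of dimension at most $k$ (its vertices and hyperedges listed), enumerate its inclusion-maximal independent sets. Vectors and sets are written as $0/1$ words of length $n$ (through characteristic vectors); words that encode no instance have no solutions. **Theorem.** For every $k\ge 2$: 1. $\textsc{EnumClosureMax}_{S_{12}^k}$ and $\textsc{EnumKMaxIndSet}$ are equivalent under polynomial delay reductions. 2. Let $\mathcal S\subseteq\{0,1\}^n$ be such that no coordinate is equal to $1$ in all vectors of $\mathcal S$ and no two distinct coordinates agree in all vectors of $\mathcal S$. Then $$Cl_{S_{12}^k}(\mathcal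 S)=\{\chi_T : T \text{ is an independent set of } \mathcal H_k(\mathcal S)\}.$$ 3. For every $n$ and every $\mathcal S\subseteq\{0,1\}^n$, $$\mathrm{Max}\bigl(Cl_{S_{12}^k}(\mathcal S)\bigr)=\{\chi_T : T \text{ is a maximal independent set of } \mathcal H_k(\mathcal S)\}.$$ -/

import Mathlib

namespace EnumRed

/-! ### Words and enumeration problems -/

/-- The finite alphabet: two bits and a separator. -/
inductive Letter where
  | zero
  | one
  | sep

abbrev Word : Type := List Letter

/-- An enumeration problem associates to each input word the set of its solutions. -/
abbrev EnumProblem : Type := Word → Set Word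

/-! ### Random access machines

Natural number registers, addition, (truncated) subtraction, multiplication, indirect addressing,
conditional jumps, a read-only input, output registers and an output instruction.
Every instruction is charged logarithmically: one unit plus the binary lengths of the register
contents it works with, whether as numbers or as addresses. -/

inductive Instr where
  /-- `R i := c` -/
  | const (i c : ℕ)
  /-- `R i := R j + R k` -/
  | add (i j k : ℕ)
  /-- `R i := R j - R k` (or `0` if `R j < R k`) -/
  | sub (i j k : ℕ)
  /-- `R i := R j * R k` -/
  | mul (i j k : ℕ)
  /-- `R i := R (R j)` -/
  | load (i j : ℕ)
  /-- `R (R i) := R j` -/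
  | store (i j : ℕ)
  /-- `R i :=` code of the input letter at position `R j` (`0` beyond the end of the input) -/
  | read (i j : ℕ)
  /-- if `R i = 0`, jump to instruction number `l` -/
  | jz (i l : ℕ)
  /-- put the letter `a` into the next free output register -/
  | write (a : Letter)
  /-- the OUTPUT instruction: output the word in the output registers, and free them -/
  | emit

/-- The code of an input letter, as a number. -/
def Letter.code : Letter → ℕ
  | .zero => 1
  | .one => 2
  | .sep => 3

/-- The number that the machine reads at position `p` of the input `w`. -/
def inputAt (w : Word) (p : ℕ) : ℕ :=
  match w[p]? with
  | none => 0
  | some a => a.code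

structure Config where
  /-- number of the next instruction -/
  pc : ℕ
  /-- contents of the registers -/
  reg : ℕ → ℕ
  /-- contents of the output registers -/
  buf : Word
  /-- time used so far -/
  clock : ℕ
  /-- the words output so far, in chronological order, each with the time of its production -/
  out : List (ℕ × Word)

def initConfig : Config where
  pc := 0
  reg := fun _ => 0
  buf := []
  clock := 0
  out := []

/-- Logarithmic cost of an instruction when the registers contain `R`
(`Nat.size` is the length of the binary representation). -/
def Instr.cost (R : ℕ → ℕ) : Instr → ℕ
  | .const _ c => 1 + c.size
  | .add _ j k => 1 + (R j).size + (R k).size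
  | .sub _ j k => 1 + (R j).size + (R k).size
  | .mul _ j k => 1 + (R j).size + (R k).size
  | .load _ j => 1 + (R j).size + (R (R j)).size
  | .store i j => 1 + (R i).size + (R j).size
  | .read _ j => 1 + (R j).size
  | .jz i _ => 1 + (R i).size
  | .write _ => 1
  | .emit => 1

/-- Effect of an instruction, apart from the clock. -/
def Instr.effect (w : Word) (c : Config) : Instr → Config
  | .const i x => { c with pc := c.pc + 1, reg := Function.update c.reg i x }
  | .add i j k =>
      { c with pc := c.pc + 1, reg := Function.update c.reg i (c.reg j + c.reg k) }
  | .sub i j k =>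
      { c with pc := c.pc + 1, reg := Function.update c.reg i (c.reg j - c.reg k) }
  | .mul i j k =>
      { c with pc := c.pc + 1, reg := Function.update c.reg i (c.reg j * c.reg k) }
  | .load i j => { c with pc := c.pc + 1, reg := Function.update c.reg i (c.reg (c.reg j)) }
  | .store i j => { c with pc := c.pc + 1, reg := Function.update c.reg (c.reg i) (c.reg j) }
  | .read i j =>
      { c with pc := c.pc + 1, reg := Function.update c.reg i (inputAt w (c.reg j)) }
  | .jz i l => { c with pc := if c.reg i = 0 then l else c.pc + 1 }
  | .write a => { c with pc := c.pc + 1, buf := c.buf ++ [a] }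
  | .emit =>
      { c with
        pc := c.pc + 1
        buf := []
        out := c.out ++ [(c.clock + 1, c.buf)] }

/-- One step of the program `P` on the input `w`; the machine halts when it leaves the program. -/
def step (P : List Instr) (w : Word) (c : Config) : Option Config :=
  match P[c.pc]? with
  | none => none
  | some ins => some { ins.effect w c with clock := c.clock + ins.cost c.reg }

/-- The program `P` halts on the input `w`, in the final configuration `c`. -/
def HaltsAt (P : List Instr) (w : Word) (c : Config) : Prop :=
  c ∈ StateTransition.eval (step P w) initConfig

/-! ### Complexity -/

/-- `f` is a polynomial time function: some machine, on every `w`, outputs the single word `f w`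
and halts within time polynomial in the length of `w`. -/
def PolyTime (f : Word → Word) : Prop :=
  ∃ (P : List Instr) (p : Polynomial ℕ), ∀ w : Word, ∃ c : Config,
    HaltsAt P w c ∧ c.out.map Prod.snd = [f w] ∧ c.clock ≤ p.eval w.length

/-- `A` can be enumerated with polynomial delay: some machine, on every `w`, halts after having
output the elements of `A w`, each exactly once, and the time before the first output, between
two consecutive outputs, and from the last output to the end is polynomial in the length
of `w`. -/
def DelayP (A : EnumProblem) : Prop :=
  ∃ (P : List Instr) (p : Polynomial ℕ), ∀ w : Word, ∃ c : Config,
    HaltsAt P w c ∧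
    (c.out.map Prod.snd).Nodup ∧
    {y | y ∈ c.out.map Prod.snd} = A w ∧
    List.IsChain (fun s t => t ≤ s + p.eval w.length)
      (0 :: (c.out.map Prod.fst ++ [c.clock]))

/-- There is a polynomial delay reduction from `A` to `B`. -/
def PolyDelayReduces (A B : EnumProblem) : Prop :=
  ∃ f : Word → Word, PolyTime f ∧ ∃ C : EnumProblem, DelayP C ∧ ∀ x : Word,
    (∀ y ∈ B (f x), ∀ z ∈ B (f x), y ≠ z → C (x ++ y) ∩ C (x ++ z) = ∅) ∧
    A x = ⋃ y ∈ B (f x), C (x ++ y)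

/-- Equivalence of enumeration problems under polynomial delay reductions. -/
def PolyDelayEquiv (A B : EnumProblem) : Prop :=
  PolyDelayReduces A B ∧ PolyDelayReduces B A

/-! ### Operations, clones, closures -/

/-- An operation over `D`: an arity and a function. -/
abbrev Operation (D : Type) : Type := Σ t : ℕ, ((Fin t → D) → D)

/-- Functions obtained from the operations of `F` and the projections by composition. -/
inductive CloneMem {D : Type} (F : Set (Operation D)) : (t : ℕ) → ((Fin t → D) → D) → Prop
  | proj {t : ℕ} (i : Fin t) : CloneMem F t (fun x => x i)
  | comp {m t : ℕ} (f : (Fin m → D) → D) (hf : (⟨m, f⟩ : Operation D) ∈ F)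
      (g : Fin m → (Fin t → D) → D) (hg : ∀ i, CloneMem F t (g i)) :
      CloneMem F t (fun x => f (fun i => g i x))

/-- The clone generated by `F`. -/
def clone {D : Type} (F : Set (Operation D)) : Set (Operation D) :=
  {f | CloneMem F f.1 f.2}

/-- `Cl F S`: the smallest set of vectors that contains `S` and is closed under the operations
of `F`, acting coordinatewise. -/
inductive Cl {D : Type} {n : ℕ} (F : Set (Operation D)) (S : Set (Fin n → D)) :
    Set (Fin n → D)
  | base (v : Fin n → D) (hv : v ∈ S) : Cl F S v
  | app (f : Operation D) (hf : f ∈ F) (v : Fin f.1 → Fin n → D) (hv : ∀ j, Cl F S (v j)) :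
      Cl F S (fun i => f.2 (fun j => v j i))

/-- The threshold function with `m` arguments: true iff at least `k` of them are. -/
def threshold (k m : ℕ) : Operation Bool :=
  ⟨m, fun x => decide (k ≤ (Finset.univ.filter (fun i => x i = true)).card)⟩

/-- The operation `x ∧ (y → z)`. -/
def andImp : Operation Bool := ⟨3, fun x => x 0 && (!(x 1) || x 2)⟩

/-- The clone `S₁₂ᵏ`. -/
def S12 (k : ℕ) : Set (Operation Bool) := clone {threshold k (k + 1), andImp}

/-! ### Hypergraphs -/

/-- The dimension of a hypergraph: the largest size of a hyperedge. -/
noncomputable def dimension {V : Type} (H : Hypergraph V) : ℕ∞ :=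
  ⨆ e ∈ H.edgeSet, e.encard

/-- Independent sets: sets of vertices that contain no hyperedge. -/
def Indep {V : Type} (H : Hypergraph V) (T : Set V) : Prop :=
  T ⊆ H.vertexSet ∧ ∀ e ∈ H.edgeSet, ¬ e ⊆ T

open Classical in
/-- The characteristic vector of a set. -/
noncomputable def charVec {n : ℕ} (T : Set (Fin n)) : Fin n → Bool := fun i => decide (i ∈ T)

/-- The hypergraph `H_k(S)` on all coordinates: its hyperedges are the sets of at most `k`
coordinates that are never simultaneously `1` in a vector of `S`. -/
def coHypergraph {n : ℕ} (k : ℕ) (S : Set (Fin n → Bool)) : Hypergraph (Fin n) where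
  vertexSet := Set.univ
  edgeSet := {I | I.ncard ≤ k ∧ ∀ u ∈ S, ¬ ∀ i ∈ I, u i = true}
  subset_vertexSet_of_mem_edgeSet' := fun _ _ => Set.subset_univ _

/-! ### Encodings and the two problems -/

/-- A vector as the word of its coordinates. -/
def vecWord {n : ℕ} (v : Fin n → Bool) : Word :=
  List.ofFn (fun i => if v i then Letter.one else Letter.zero)

/-- A list of vectors of size `n`: the size in unary, then the vectors one after the other, with
a separator after the size and after each vector. -/
def familyWord (n : ℕ) (L : List (Fin n → Bool)) : Word :=
  List.replicate n Letter.one ++ [Letter.sep] ++ L.flatMap (fun v => vecWord v ++ [Letter.sep])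

/-- `w` encodes the set `S` of vectors of size `n`, given by a list of its elements. -/
def EncodesVectors (w : Word) {n : ℕ} (S : Set (Fin n → Bool)) : Prop :=
  ∃ L : List (Fin n → Bool), S = {v | v ∈ L} ∧ w = familyWord n L

/-- `w` encodes the hypergraph `H` on `n` vertices, given by its number of vertices and a list of
its hyperedges, each by its characteristic vector. -/
def EncodesHypergraph (w : Word) {n : ℕ} (H : Hypergraph (Fin n)) : Prop :=
  H.vertexSet = Set.univ ∧
  ∃ L : List (Set (Fin n)), H.edgeSet = {e | e ∈ L} ∧ w = familyWord n (L.map charVec)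

/-- Given a set `S` of Boolean vectors, enumerate the maximal elements of
`Cl F S` without the two constant vectors. Words that encode no instance have no solution. -/
def EnumClosureMax (F : Set (Operation Bool)) : EnumProblem := fun w =>
  {y | ∃ (n : ℕ) (S : Set (Fin n → Bool)) (v : Fin n → Bool),
    EncodesVectors w S ∧
    Maximal (fun u => u ∈ Cl F S \ {(fun _ => false), (fun _ => true)}) v ∧
    y = vecWord v}

/-- Given a hypergraph of dimension at most `k`, enumerate its maximal independent sets, as
characteristic vectors. Words that encode no instance have no solution. -/
def EnumKMaxIndSet (k : ℕ) : EnumProblem := fun w =>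
  {y | ∃ (n : ℕ) (H : Hypergraph (Fin n)) (T : Set (Fin n)),
    EncodesHypergraph w H ∧ dimension H ≤ k ∧ Maximal (Indep H) T ∧ y = vecWord (charVec T)}

end EnumRed

open EnumRed

/-! Closure and independence. Each vector of the closure is the characteristic vector of an
independent set (`indep_of_mem_cl`). For a hyperedge `I`, having a `0` inside `I` is preserved by
both generators: among `k + 1` vectors with a `0` in `I`, two share its position by pigeonhole, so
the threshold is `0` there, and `x ∧ (y → z)` lies below `x`. Conversely (`cl_of_indep`), let `T` be
independent, contain every coordinate constantly `1` on `S`, and be a union of twin classes, twins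
being coordinates that agree on `S`. If `T` meets at most `k` classes of non-constant coordinates,
independence applied to representatives gives `u ∈ S` equal to `1` on `T`. Between the conjunction
of all vectors and `u`, the operation `x ∧ (y → z)` provides Boolean complements, so every
compatible set below `u` is reached (`cl_of_le`). Otherwise choose `k + 1` classes in `T` and remove
one at a time: the smaller sets are in the closure by induction, each point of `T` is lost at most
once, and the threshold restores `T`. Part 2 is the case where compatibility is automatic. For part
3, a maximal independent set is compatible, because adding a constant coordinate or a twin of a
member keeps independence.

Reductions. From closures to hypergraphs, the hyperedges of `coHypergraph` are found by testing all
sets of at most `k` coordinates, polynomially many since `k` is fixed. A solution is returned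
unchanged, except that the zero vector is dropped. If the full set is independent, it is the only
solution on the hypergraph side, and it is excluded on the other; the maximal vectors are then the
nonzero complements of the non-constant twin classes (`maximal_cl_diff_of_indep`), computed directly
from the input. From hypergraphs to closures, the family consists of the independent sets of at most
`k` elements, with a constant `1` and a constant `0` coordinate added (`extend`). Its co-hypergraph
has the independent sets of the original one up to these coordinates (`indep_indSet`), and neither
constant vector belongs to the closure.

Machines. All algorithms are written in a small language `Tm` of bounded loops, compiled once and
for all to machine code (`Tm.correct`). Its programs run in polynomial time, which bounds every
delay as well. -/

namespace EnumRed

/-! ### A language of bounded loops and its compilation. -/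

/-- Arithmetic operations of the machine. -/
inductive BinOp where
  | add
  | sub
  | mul

def BinOp.eval : BinOp → ℕ → ℕ → ℕ
  | .add, x, y => x + y
  | .sub, x, y => x - y
  | .mul, x, y => x * y

def BinOp.instr : BinOp → ℕ → ℕ → ℕ → Instr
  | .add => Instr.add
  | .sub => Instr.sub
  | .mul => Instr.mul

/-- A small language of bounded programs: each has a numerical value and produces a sequence of
output actions. Variables are named by numbers. -/
inductive Tm where
  | var (v : ℕ)
  | const (c : ℕ)
  | bin (o : BinOp) (x y : Tm)
  /-- the code of the letter at the given position -/
  | read (x : Tm)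
  /-- the sum of the values of `y`, for the variable `v` running from `0` to `x - 1` -/
  | sum (v : ℕ) (x y : Tm)
  /-- run `y` if the value of `x` is not `0` -/
  | cond (x y : Tm)
  | write (l : Letter)
  | emit

/-- Output actions: writing a letter, or the OUTPUT instruction. -/
abbrev Ops := List (Option Letter)

namespace Tm

def eval (w : Word) : Tm → (ℕ → ℕ) → ℕ
  | var v, e => e v
  | const c, _ => c
  | bin o x y, e => o.eval (x.eval w e) (y.eval w e)
  | read x, e => inputAt w (x.eval w e)
  | sum v x y, e => ∑ i ∈ Finset.range (x.eval w e), y.eval w (Function.update e v i)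
  | cond x y, e => if x.eval w e = 0 then 0 else y.eval w e
  | write _, _ => 0
  | emit, _ => 0

def ops (w : Word) : Tm → (ℕ → ℕ) → Ops
  | var _, _ => []
  | const _, _ => []
  | bin _ x y, e => x.ops w e ++ y.ops w e
  | read x, e => x.ops w e
  | sum v x y, e =>
      x.ops w e ++ (List.range (x.eval w e)).flatMap fun i => y.ops w (Function.update e v i)
  | cond x y, e => x.ops w e ++ if x.eval w e = 0 then [] else y.ops w e
  | write l, _ => [some l]
  | emit, _ => [none]

/-- Machine code, to be placed at address `a`; the temporary registers from number `s` on may be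
used, and the value is left in the first of them. Variables live in the even registers,
temporaries in the odd ones. -/
def code : Tm → ℕ → ℕ → List Instr
  -- There is no move instruction: a register is cleared, then added to.
  | var v, _, s => [.const (2*s+1) 0, .add (2*s+1) (2*v) (2*s+1)]
  | const c, _, s => [.const (2*s+1) c]
  | bin o x y, a, s =>
      x.code a s ++ (y.code (a + (x.code a s).length) (s+1) ++
        [o.instr (2*s+1) (2*s+1) (2*s+3)])
  | read x, a, s => x.code a s ++ [.read (2*s+1) (2*s+1)]
  | sum v x y, a, s =>
      -- Register `2*s+1` holds the number of rounds, `2*s+3` the saved value of the variable,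
      -- `2*s+5` the running sum, and `2*s+7` in turn the exit test, the value of the body, the
      -- increment, and a `0` that makes the backward jump unconditional. The loop head is at `b+4`,
      -- the body ends at `m`, the exit is at `m+5`.
      let b := a + (x.code a s).length
      let m := b + 6 + (y.code (b+6) (s+3)).length
      x.code a s ++ ([.const (2*s+3) 0, .add (2*s+3) (2*v) (2*s+3), .const (2*v) 0,
        .const (2*s+5) 0] ++ ([.sub (2*s+7) (2*s+1) (2*v)] ++ ([.jz (2*s+7) (m+5)] ++
        (y.code (b+6) (s+3) ++ ([.add (2*s+5) (2*s+5) (2*s+7), .const (2*s+7) 1,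
        .add (2*v) (2*v) (2*s+7), .const (2*s+7) 0] ++ ([.jz (2*s+7) (b+4)] ++
        [.const (2*s+7) 0, .add (2*v) (2*s+3) (2*s+7), .add (2*s+1) (2*s+5) (2*s+7)]))))))
  | cond x y, a, s =>
      let b := a + (x.code a s).length + 1
      x.code a s ++ ([.jz (2*s+1) (b + (y.code b s).length)] ++ y.code b s)
  | write l, _, s => [.write l, .const (2*s+1) 0]
  | emit, _, s => [.emit, .const (2*s+1) 0]

/-- A bound for the value, when the variables are at most `M`. -/
def bd : Tm → ℕ → ℕ
  | var _, M => M
  | const c, _ => c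
  -- One bound for all three operations.
  | bin _ x y, M => x.bd M + y.bd M + x.bd M * y.bd M
  | read _, _ => 3
  | sum _ x y, M => x.bd M * y.bd (M + x.bd M)
  | cond _ y, M => y.bd M
  | write _, _ => 0
  | emit, _ => 0

/-- A bound for the running time, when the variables are at most `M`. -/
def cost : Tm → ℕ → ℕ
  | var _, M => M + 2
  | const c, _ => 1 + c
  | bin _ x y, M => x.cost M + y.cost M + (1 + x.bd M + y.bd M)
  | read x, M => x.cost M + (1 + x.bd M)
  | sum _ x y, M =>
      let B := x.bd M
      let C := y.bd (M + B)
      x.cost M + (5 + M) + B * (y.cost (M + B) + (10 + 4 * B + B * C + C)) +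
        (10 + 3 * B + M + B * C)
  | cond x y, M => x.cost M + (1 + x.bd M) + y.cost M
  | write _, _ => 2
  | emit, _ => 2

end Tm

/-- Effect of a sequence of output actions on the output registers and the list of outputs. -/
def runOps (l : Ops) (s : Word × List Word) : Word × List Word :=
  l.foldl (fun s a => match a with
    | some l => (s.1 ++ [l], s.2)
    | none => ([], s.2 ++ [s.1])) s

@[simp] theorem runOps_nil (s) : runOps [] s = s := rfl

theorem runOps_append (l l' : Ops) (s) : runOps (l ++ l') s = runOps l' (runOps l s) :=
  List.foldl_append

/-- The outputs of a configuration, without their times. -/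
def Config.outputs (c : Config) : Word × List Word := (c.buf, c.out.map Prod.snd)

theorem inputAt_le (w : Word) (p : ℕ) : inputAt w p ≤ 3 := by
  unfold inputAt
  split
  · omega
  · rename_i a _
    cases a <;> simp [Letter.code]

/-- The sum `M + B` stands in for the maximum so that bounds remain polynomial in `M`. -/
theorem update_le {e : ℕ → ℕ} {M B : ℕ} (h : ∀ i, e i ≤ M) (v : ℕ) {x : ℕ} (hx : x ≤ B) (i : ℕ) :
    Function.update e v x i ≤ M + B := by
  have := h i
  rw [Function.update_apply]
  split_ifs <;> omega

theorem Tm.eval_le_bd (w : Word) (t : Tm) (e : ℕ → ℕ) (M : ℕ) (h : ∀ i, e i ≤ M) :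
    t.eval w e ≤ t.bd M := by
  induction t generalizing e M with
  | var v => exact h v
  | const c => exact le_rfl
  | bin o x y hx hy =>
    have h1 := hx e M h
    have h2 := hy e M h
    have h3 := Nat.mul_le_mul h1 h2
    cases o <;> simp only [eval, BinOp.eval, bd] <;> omega
  | read x => exact inputAt_le _ _
  | sum v x y hx hy =>
    have h1 := hx e M h
    simp only [eval, bd]
    refine (Finset.sum_le_card_nsmul _ _ (y.bd (M + x.bd M)) fun i hi => ?_).trans ?_
    · exact hy _ _ (update_le h v (by have := Finset.mem_range.1 hi; omega))
    · simp only [Finset.card_range, smul_eq_mul]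
      exact Nat.mul_le_mul_right _ h1
  | cond x y _ hy =>
    have := hy e M h
    simp only [eval, bd]
    split_ifs <;> omega
  | write | emit => exact le_rfl

/-- Logarithmic costs are bounded crudely by the values themselves; this is harmless, because all
values stay polynomial. -/
theorem size_le_self (n : ℕ) : n.size ≤ n := Nat.size_le.2 n.lt_two_pow_self

/-! ### Correctness and running time of the compiled code. -/

/-- The code `l` is found in `P` at address `a`. -/
def CodeAt (P : List Instr) : ℕ → List Instr → Prop
  | _, [] => True
  | a, i :: l => P[a]? = some i ∧ CodeAt P (a + 1) l

theorem codeAt_append {P : List Instr} {a : ℕ} {l l' : List Instr} :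
    CodeAt P a (l ++ l') ↔ CodeAt P a l ∧ CodeAt P (a + l.length) l' := by
  induction l generalizing a with
  | nil => simp [CodeAt]
  | cons i l ih =>
    simp only [List.cons_append, CodeAt, ih, List.length_cons, and_assoc]
    rw [show a + 1 + l.length = a + (l.length + 1) by omega]

theorem codeAt_self (l' l : List Instr) : CodeAt (l' ++ l) l'.length l := by
  induction l generalizing l' with
  | nil => trivial
  | cons i l ih =>
    refine ⟨by simp, ?_⟩
    have := ih (l' ++ [i])
    simpa using this

/-- One instruction, with its cost. -/
def exec (w : Word) (c : Config) (i : Instr) : Config :=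
  { i.effect w c with clock := c.clock + i.cost c.reg }

def Instr.straight : Instr → Bool
  | .jz _ _ => false
  | _ => true

theorem reaches_instr {P : List Instr} {w : Word} {c : Config} {i : Instr}
    (h : P[c.pc]? = some i) : StateTransition.Reaches (step P w) c (exec w c i) := by
  refine Relation.ReflTransGen.single ?_
  simp [step, h, exec]

theorem exec_pc {w : Word} {c : Config} {i : Instr} (h : i.straight = true) :
    (exec w c i).pc = c.pc + 1 := by
  cases i <;> simp_all [exec, Instr.effect, Instr.straight]

theorem reaches_straight {P : List Instr} {w : Word} {l : List Instr} {c : Config}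
    (hl : ∀ i ∈ l, i.straight = true) (h : CodeAt P c.pc l) :
    StateTransition.Reaches (step P w) c (l.foldl (exec w) c) ∧
      (l.foldl (exec w) c).pc = c.pc + l.length := by
  induction l generalizing c with
  | nil => exact ⟨.refl, rfl⟩
  | cons i l ih =>
    have hp := exec_pc (w := w) (c := c) (hl i (by simp))
    obtain ⟨h1, h2⟩ := ih (c := exec w c i) (fun j hj => hl j (by simp [hj]))
      (by rw [hp]; exact h.2)
    refine ⟨(reaches_instr h.1).trans h1, ?_⟩
    rw [List.foldl_cons, h2, hp, List.length_cons]
    omega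

/-- What running the code of `t` achieves. -/
structure Tm.Result (t : Tm) (w : Word) (e : ℕ → ℕ) (s M : ℕ) (c c' : Config) : Prop where
  val : c'.reg (2*s+1) = t.eval w e
  vars : ∀ i, c'.reg (2*i) = e i
  temps : ∀ i < s, c'.reg (2*i+1) = c.reg (2*i+1)
  outs : c'.outputs = runOps (t.ops w e) c.outputs
  time : c'.clock ≤ c.clock + t.cost M

/-- Any address, any first free temporary and any starting configuration with the variables in place
are allowed, so that the induction on terms can use it for subprograms. The bound `M` only serves
the clock. -/
def Tm.Correct (t : Tm) : Prop :=
  ∀ (P : List Instr) (w : Word) (a s : ℕ) (c : Config) (e : ℕ → ℕ) (M : ℕ),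
    CodeAt P a (t.code a s) → c.pc = a → (∀ i, c.reg (2*i) = e i) → (∀ i, e i ≤ M) →
    ∃ c', StateTransition.Reaches (step P w) c c' ∧ c'.pc = a + (t.code a s).length ∧
      t.Result w e s M c c'

namespace Tm

theorem correct_var (v : ℕ) : (var v).Correct := by
  intro P w a s c e M hP hpc hv hM
  subst hpc
  obtain ⟨h1, h2⟩ := reaches_straight (w := w) (by simp [code, Instr.straight]) hP
  have h6 : 2 * v ≠ 2 * s + 1 := by omega
  refine ⟨_, h1, h2, ?_, ?_, ?_, ?_, ?_⟩
  · simp [code, exec, Instr.effect, eval, hv, h6]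
  · intro i
    simp [code, exec, Instr.effect, Function.update_apply, hv]
    intro h; omega
  · intro i hi
    simp [code, exec, Instr.effect, Function.update_apply]
    intro h; omega
  · simp [code, exec, Instr.effect, Config.outputs, ops]
  · have h3 := hM v
    have := size_le_self (e v)
    simp [code, exec, Instr.cost, Instr.effect, cost, hv, h6]
    omega

theorem correct_const (v : ℕ) : (const v).Correct := by
  intro P w a s c e M hP hpc hv hM
  subst hpc
  obtain ⟨h1, h2⟩ := reaches_straight (w := w) (by simp [code, Instr.straight]) hP
  refine ⟨_, h1, h2, ?_, ?_, ?_, ?_, ?_⟩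
  · simp [code, exec, Instr.effect, eval]
  · intro i
    simp [code, exec, Instr.effect, Function.update_apply, hv]
    intro h; omega
  · intro i hi
    simp [code, exec, Instr.effect, Function.update_apply]
    intro h; omega
  · simp [code, exec, Instr.effect, Config.outputs, ops]
  · have := size_le_self v
    simp [code, exec, Instr.cost, Instr.effect, cost]
    omega

theorem correct_write (l : Letter) : (write l).Correct := by
  intro P w a s c e M hP hpc hv hM
  subst hpc
  obtain ⟨h1, h2⟩ := reaches_straight (w := w) (by simp [code, Instr.straight]) hP
  refine ⟨_, h1, h2, ?_, ?_, ?_, ?_, ?_⟩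
  · simp [code, exec, Instr.effect, eval]
  · intro i
    simp [code, exec, Instr.effect, Function.update_apply, hv]
    intro h; omega
  · intro i hi
    simp [code, exec, Instr.effect, Function.update_apply]
    intro h; omega
  · simp [code, exec, Instr.effect, Config.outputs, ops, runOps]
  · simp [code, exec, Instr.cost, cost]

theorem correct_emit : emit.Correct := by
  intro P w a s c e M hP hpc hv hM
  subst hpc
  obtain ⟨h1, h2⟩ := reaches_straight (w := w) (by simp [code, Instr.straight]) hP
  refine ⟨_, h1, h2, ?_, ?_, ?_, ?_, ?_⟩
  · simp [code, exec, Instr.effect, eval]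
  · intro i
    simp [code, exec, Instr.effect, Function.update_apply, hv]
    intro h; omega
  · intro i hi
    simp [code, exec, Instr.effect, Function.update_apply]
    intro h; omega
  · simp [code, exec, Instr.effect, Config.outputs, ops, runOps]
  · simp [code, exec, Instr.cost, cost]

theorem correct_read (x : Tm) (hx : x.Correct) : (read x).Correct := by
  intro P w a s c e M hP hpc hv hM
  simp only [code, codeAt_append] at hP
  obtain ⟨c1, r1, p1, q1⟩ := hx P w a s c e M hP.1 hpc hv hM
  have hb := x.eval_le_bd w e M hM
  refine ⟨_, r1.trans (reaches_instr (i := .read (2*s+1) (2*s+1)) (p1 ▸ hP.2.1)), ?_, ?_, ?_, ?_,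
    ?_, ?_⟩
  · simp [exec, Instr.effect, p1, code]; omega
  · simp [exec, Instr.effect, eval, q1.val]
  · intro i
    simp [exec, Instr.effect, Function.update_apply, q1.vars]
    intro h; omega
  · intro i hi
    have := q1.temps i hi
    simp [exec, Instr.effect, Function.update_apply, this]
    intro h; omega
  · simpa [Config.outputs, exec, Instr.effect, ops] using q1.outs
  · have h1 := q1.time
    have := size_le_self (x.eval w e)
    simp only [exec, Instr.cost, q1.val, cost]
    omega

theorem correct_bin (o : BinOp) (x y : Tm) (hx : x.Correct) (hy : y.Correct) :
    (bin o x y).Correct := by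
  intro P w a s c e M hP hpc hv hM
  simp only [code, codeAt_append] at hP
  obtain ⟨c1, r1, p1, q1⟩ := hx P w a s c e M hP.1 hpc hv hM
  -- The second argument works above temporary `s`, where the first value is kept.
  obtain ⟨c2, r2, p2, q2⟩ := hy P w _ (s+1) c1 e M hP.2.1 p1 q1.vars hM
  have hb := x.eval_le_bd w e M hM
  have hb' := y.eval_le_bd w e M hM
  have h1 : c2.reg (2*s+1) = x.eval w e := by rw [q2.temps s (by omega), q1.val]
  have h2 : c2.reg (2*s+3) = y.eval w e := q2.val
  have ho := q2.outs
  rw [q1.outs, ← runOps_append] at ho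
  have ht1 := q1.time
  have ht2 := q2.time
  have hs1 := size_le_self (x.eval w e)
  have hs2 := size_le_self (y.eval w e)
  refine ⟨_, r1.trans (r2.trans (reaches_instr (i := o.instr (2*s+1) (2*s+1) (2*s+3))
    (p2 ▸ hP.2.2.1))), ?_, ?_, ?_, ?_, ?_, ?_⟩
  · cases o <;> simp [exec, Instr.effect, BinOp.instr, p2, code] <;> omega
  · cases o <;> simp [exec, Instr.effect, BinOp.instr, eval, BinOp.eval, h1, h2]
  · intro i
    cases o <;> simp [exec, Instr.effect, BinOp.instr, Function.update_apply, q2.vars] <;>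
      (intro h; omega)
  · intro i hi
    have := q1.temps i hi
    have := q2.temps i (by omega)
    cases o <;> simp [exec, Instr.effect, BinOp.instr, Function.update_apply, *] <;>
      (intro h; omega)
  · cases o <;> simpa [Config.outputs, exec, BinOp.instr, Instr.effect, ops] using ho
  · cases o <;> simp only [exec, BinOp.instr, Instr.cost, h1, h2, cost] <;> omega

theorem correct_cond (x y : Tm) (hx : x.Correct) (hy : y.Correct) : (cond x y).Correct := by
  intro P w a s c e M hP hpc hv hM
  simp only [code, codeAt_append] at hP
  obtain ⟨c1, r1, p1, q1⟩ := hx P w a s c e M hP.1 hpc hv hM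
  have hb := x.eval_le_bd w e M hM
  have hs := size_le_self (x.eval w e)
  have r2 := reaches_instr (w := w) (by rw [p1]; exact hP.2.1.1)
  have ht := q1.time
  by_cases h0 : x.eval w e = 0
  -- The jump is taken, and the register of the test already holds the required value `0`.
  · refine ⟨_, r1.trans r2, ?_, ?_, ?_, ?_, ?_, ?_⟩
    · simp [exec, Instr.effect, code, q1.val, h0]; omega
    · simp [exec, Instr.effect, eval, q1.val, h0]
    · exact q1.vars
    · exact q1.temps
    · simpa [Config.outputs, exec, Instr.effect, ops, h0] using q1.outs
    · simp only [exec, Instr.cost, q1.val, cost]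
      omega
  · obtain ⟨c2, r3, p3, q3⟩ := hy P w _ s (exec w c1 (.jz (2*s+1) (a + (x.code a s).length + 1 +
      (y.code (a + (x.code a s).length + 1) s).length))) e M hP.2.2
      (by simp [exec, Instr.effect, q1.val, h0, p1]) q1.vars hM
    have ht3 := q3.time
    refine ⟨c2, r1.trans (r2.trans r3), ?_, ?_, q3.vars, ?_, ?_, ?_⟩
    · simp [p3, code]; omega
    · simp [eval, h0, q3.val]
    · intro i hi
      rw [q3.temps i hi]
      exact q1.temps i hi
    · rw [q3.outs]
      have := q1.outs
      simp only [ops, h0, if_false, runOps_append]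
      rw [← this]
      rfl
    · simp only [exec, Instr.cost, q1.val, cost] at ht3 ⊢
      omega

/-- State at the head of the loop of `sum v x y`, after `i` rounds. -/
structure LoopState (v : ℕ) (y : Tm) (w : Word) (e : ℕ → ℕ) (s N K i : ℕ) (c c' : Config) :
    Prop where
  bound : c'.reg (2*s+1) = N
  saved : c'.reg (2*s+3) = e v
  acc : c'.reg (2*s+5) = ∑ j ∈ Finset.range i, y.eval w (Function.update e v j)
  vars : ∀ u, c'.reg (2*u) = Function.update e v i u
  temps : ∀ u < s, c'.reg (2*u+1) = c.reg (2*u+1)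
  outs : c'.outputs =
    runOps ((List.range i).flatMap fun j => y.ops w (Function.update e v j)) c.outputs
  time : c'.clock ≤ c.clock + i * K

/-- The exit test is `N - i`, which is not `0` while `i < N`. The body starts its temporaries at
`s+3`, above the bound, the saved variable and the sum, so these survive it. -/
theorem loop_round {P : List Instr} {v : ℕ} {y : Tm} (hy : y.Correct) {w : Word} {e : ℕ → ℕ}
    {s b M B i : ℕ} {c c' : Config} (hM : ∀ i, e i ≤ M) {N : ℕ} (hi : i < N) (hN : N ≤ B)
    {m : ℕ} (hm : m = b + 6 + (y.code (b+6) (s+3)).length)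
    (h1 : CodeAt P (b+4) [.sub (2*s+7) (2*s+1) (2*v)])
    (h2 : CodeAt P (b+5) [.jz (2*s+7) (m+5)])
    (h3 : CodeAt P (b+6) (y.code (b+6) (s+3)))
    (h4 : CodeAt P m [.add (2*s+5) (2*s+5) (2*s+7), .const (2*s+7) 1,
        .add (2*v) (2*v) (2*s+7), .const (2*s+7) 0])
    (h5 : CodeAt P (m+4) [.jz (2*s+7) (b+4)])
    (hpc : c'.pc = b + 4)
    (hl : LoopState v y w e s N (y.cost (M + B) + (10 + 4 * B + B * y.bd (M + B) + y.bd (M + B)))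
      i c c') :
    ∃ c'', StateTransition.Reaches (step P w) c' c'' ∧ c''.pc = b + 4 ∧
      LoopState v y w e s N (y.cost (M + B) + (10 + 4 * B + B * y.bd (M + B) + y.bd (M + B)))
      (i + 1) c c'' := by
  have hreg : c'.reg (2*v) = i := by simp [hl.vars]
  have hM' := update_le hM v (show i ≤ B by omega)
  have hb := y.eval_le_bd w _ _ hM'
  have hacc : c'.reg (2*s+5) ≤ B * y.bd (M + B) := by
    rw [hl.acc]
    refine (Finset.sum_le_card_nsmul _ _ (y.bd (M + B)) fun j hj => ?_).trans ?_
    · exact y.eval_le_bd _ _ _ (update_le hM v (by have := Finset.mem_range.1 hj; omega))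
    · simp only [Finset.card_range, smul_eq_mul]
      exact Nat.mul_le_mul_right _ (by omega)
  have r1 := reaches_instr (w := w) (c := c') (hpc ▸ h1.1)
  have hr1 : (exec w c' (.sub (2*s+7) (2*s+1) (2*v))).reg (2*s+7) = N - i := by
    simp [exec, Instr.effect, hl.bound, hreg]
  have ht1 : (exec w c' (.sub (2*s+7) (2*s+1) (2*v))).clock ≤ c'.clock + 1 + 2 * B := by
    have := size_le_self N
    have := size_le_self i
    simp only [exec, Instr.cost, hl.bound, hreg]
    omega
  have hp1 : (exec w c' (.sub (2*s+7) (2*s+1) (2*v))).pc = b + 5 := by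
    simp [exec, Instr.effect, hpc]
  have hv1 : ∀ u, (exec w c' (.sub (2*s+7) (2*s+1) (2*v))).reg (2*u) =
      Function.update e v i u := by
    intro u
    rw [← hl.vars u]
    simp only [exec, Instr.effect, Function.update_apply]
    rw [if_neg (by omega)]
  have hq1 : ∀ u < s + 3, (exec w c' (.sub (2*s+7) (2*s+1) (2*v))).reg (2*u+1) =
      c'.reg (2*u+1) := by
    intro u hu
    simp only [exec, Instr.effect, Function.update_apply]
    rw [if_neg (by omega)]
  have ho1 : (exec w c' (.sub (2*s+7) (2*s+1) (2*v))).outputs = c'.outputs := rfl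
  generalize exec w c' (.sub (2*s+7) (2*s+1) (2*v)) = c1 at *
  have r2 := reaches_instr (w := w) (c := c1) (hp1 ▸ h2.1)
  have hp2 : (exec w c1 (.jz (2*s+7) (m+5))).pc = b + 6 := by
    simp only [exec, Instr.effect, hr1]
    rw [if_neg (by omega), hp1]
  have ht2 : (exec w c1 (.jz (2*s+7) (m+5))).clock ≤ c1.clock + 1 + B := by
    have := size_le_self (N - i)
    simp only [exec, Instr.cost, hr1]
    omega
  obtain ⟨c3, r3, p3, q3⟩ := hy P w _ (s+3) _ _ (M + B) h3 hp2 hv1 hM'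
  rw [← hm] at p3
  obtain ⟨r4, p4⟩ := reaches_straight (w := w) (by simp [Instr.straight]) (p3 ▸ h4)
  have ha : c3.reg (2*s+5) = c'.reg (2*s+5) :=
    (q3.temps (s+2) (by omega)).trans (hq1 (s+2) (by omega))
  have hval : c3.reg (2*s+7) = y.eval w (Function.update e v i) := q3.val
  have hv3 : c3.reg (2*v) = i := by simp [q3.vars]
  have ht4 : (List.foldl (exec w) c3 [.add (2*s+5) (2*s+5) (2*s+7), .const (2*s+7) 1,
        .add (2*v) (2*v) (2*s+7), .const (2*s+7) 0]).clock ≤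
        c3.clock + 6 + B * y.bd (M + B) + y.bd (M + B) + B := by
    have := size_le_self (c'.reg (2*s+5))
    have := size_le_self (y.eval w (Function.update e v i))
    have := size_le_self i
    have h6 : 2 * v ≠ 2*s+7 := by omega
    have h7 : 2 * v ≠ 2*s+5 := by omega
    simp [exec, Instr.cost, Instr.effect, ha, hval, hv3, h6, h7]
    omega
  have hr4 : ∀ u, (List.foldl (exec w) c3 [.add (2*s+5) (2*s+5) (2*s+7), .const (2*s+7) 1,
        .add (2*v) (2*v) (2*s+7), .const (2*s+7) 0]).reg u = if u = 2 * s + 7 then 0 else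
          if u = 2 * v then i + 1 else if u = 2 * s + 5 then
          c'.reg (2*s+5) + y.eval w (Function.update e v i) else c3.reg u := by
    intro u
    have h6 : 2 * v ≠ 2*s+7 := by omega
    have h7 : 2 * v ≠ 2*s+5 := by omega
    simp [exec, Instr.effect, Function.update_apply, ha, hval, hv3, h6, h7]
    grind
  have ho4 : (List.foldl (exec w) c3 [.add (2*s+5) (2*s+5) (2*s+7), .const (2*s+7) 1,
        .add (2*v) (2*v) (2*s+7), .const (2*s+7) 0]).outputs = c3.outputs := rfl
  generalize (List.foldl (exec w) c3 _) = c4 at *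
  have p4' : c4.pc = m + 4 := by simp [p4, p3]
  have r5 := reaches_instr (w := w) (c := c4) (p4' ▸ h5.1)
  have hz : c4.reg (2*s+7) = 0 := by simp [hr4]
  refine ⟨_, r1.trans (r2.trans (r3.trans (r4.trans r5))), ?_, ?_⟩
  · simp [exec, Instr.effect, hz]
  · have ht3 := q3.time
    have ht0 := hl.time
    have g1 : ∀ u < s + 2, c4.reg (2*u+1) = c'.reg (2*u+1) := by
      intro u hu
      rw [hr4, if_neg (by omega), if_neg (by omega), if_neg (by omega), q3.temps u (by omega)]
      exact hq1 u (by omega)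
    refine ⟨?_, ?_, ?_, ?_, ?_, ?_, ?_⟩
    · exact (g1 s (by omega)).trans hl.bound
    · exact (g1 (s+1) (by omega)).trans hl.saved
    · simp only [exec, Instr.effect, hr4]
      rw [if_neg (by omega), if_neg (by omega), if_pos trivial, Finset.sum_range_succ, hl.acc]
    · intro u
      simp only [exec, Instr.effect, hr4]
      rw [if_neg (by omega), if_neg (show 2 * u ≠ 2 * s + 5 by omega), q3.vars]
      simp only [Function.update_apply]
      grind
    · intro u hu
      exact (g1 u (by omega)).trans (hl.temps u hu)
    · have h8 : c3.outputs = runOps _ c1.outputs := q3.outs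
      change c4.outputs = _
      rw [ho4, h8, ho1, hl.outs, ← runOps_append, List.range_succ, List.flatMap_append]
      simp
    · simp only [exec, Instr.cost, hz, Nat.size_zero, Nat.add_mul, one_mul] at ht3 ⊢
      simp only [exec, Instr.cost] at ht2
      omega

theorem correct_sum (v : ℕ) (x y : Tm) (hx : x.Correct) (hy : y.Correct) :
    (sum v x y).Correct := by
  intro P w a s c e M hP hpc hv hM
  simp only [code] at hP
  generalize hm : a + (x.code a s).length + 6 +
    (y.code (a + (x.code a s).length + 6) (s+3)).length = m at *
  generalize hb : a + (x.code a s).length = b at *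
  rw [codeAt_append, codeAt_append, codeAt_append, codeAt_append, codeAt_append, codeAt_append,
    codeAt_append, hb] at hP
  simp only [List.length_cons, List.length_nil, Nat.zero_add, Nat.add_assoc,
    Nat.reduceAdd] at hP hm
  rw [hm, show b + (6 + ((y.code (b + 6) (s + 3)).length + 4)) = m + 4 by omega,
    show b + (6 + ((y.code (b + 6) (s + 3)).length + 5)) = m + 5 by omega] at hP
  obtain ⟨hP0, hP1, hP2, hP3, hP4, hP5, hP6, hP7⟩ := hP
  obtain ⟨c1, r1, p1, q1⟩ := hx P w a s c e M hP0 hpc hv hM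
  rw [hb] at p1
  have hN := x.eval_le_bd w e M hM
  generalize hNN : x.eval w e = N at *
  set B := x.bd M with hB
  set K := y.cost (M + B) + (10 + 4 * B + B * y.bd (M + B) + y.bd (M + B)) with hK
  obtain ⟨r2, p2⟩ := reaches_straight (w := w) (by simp [Instr.straight]) (p1 ▸ hP1)
  have hl0 : LoopState v y w e s N K 0 (List.foldl (exec w) c1 [.const (2*s+3) 0,
      .add (2*s+3) (2*v) (2*s+3), .const (2*v) 0, .const (2*s+5) 0]) (List.foldl (exec w) c1
      [.const (2*s+3) 0, .add (2*s+3) (2*v) (2*s+3), .const (2*v) 0, .const (2*s+5) 0]) := by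
    have h6 : 2 * v ≠ 2*s+3 := by omega
    have h7 : 2 * v ≠ 2*s+5 := by omega
    have h8 : ∀ u, 2 * u ≠ 2*s+3 := by omega
    have h9 : ∀ u, 2 * u ≠ 2*s+5 := by omega
    have h10 : 2 * s + 1 ≠ 2 * v := by omega
    have h11 : 2 * s + 3 ≠ 2 * v := by omega
    refine ⟨?_, ?_, ?_, ?_, fun _ _ => rfl, rfl, by omega⟩
    · simp [exec, Instr.effect, Function.update_apply, q1.val, hNN, h10]
    · simp [exec, Instr.effect, q1.vars, h6, h11]
    · simp [exec, Instr.effect, Function.update_apply]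
    · intro u
      simp [exec, Instr.effect, Function.update_apply, q1.vars, h8, h9]
  have ht2 : (List.foldl (exec w) c1 [.const (2*s+3) 0,
      .add (2*s+3) (2*v) (2*s+3), .const (2*v) 0, .const (2*s+5) 0]).clock ≤
      c1.clock + 5 + M := by
    have := size_le_self (e v)
    have := hM v
    have h6 : 2 * v ≠ 2*s+3 := by omega
    simp [exec, Instr.effect, Instr.cost, q1.vars, h6]
    omega
  have hq2 : ∀ u < s, (List.foldl (exec w) c1 [.const (2*s+3) 0,
      .add (2*s+3) (2*v) (2*s+3), .const (2*v) 0, .const (2*s+5) 0]).reg (2*u+1) =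
      c1.reg (2*u+1) := by
    intro u hu
    have h6 : 2 * u + 1 ≠ 2*s+3 := by omega
    have h7 : 2 * u + 1 ≠ 2*s+5 := by omega
    have h8 : 2 * u + 1 ≠ 2*v := by omega
    have h9 : 2 * u ≠ 2 * s + 2 := by omega
    have h10 : 2 * u ≠ 2 * s + 4 := by omega
    simp [exec, Instr.effect, Function.update_apply, h8, h9, h10]
  have ho2 : (List.foldl (exec w) c1 [.const (2*s+3) 0,
      .add (2*s+3) (2*v) (2*s+3), .const (2*v) 0, .const (2*s+5) 0]).outputs =
      c1.outputs := rfl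
  generalize List.foldl (exec w) c1 _ = c2 at *
  have p2' : c2.pc = b + 4 := by simp [p2, p1]
  -- After `N` rounds the test `N - N` is `0`; the jump leads to the epilogue, which restores the
  -- loop variable and moves the sum to the result register.
  have loop : ∀ i ≤ N, ∃ c', StateTransition.Reaches (step P w) c2 c' ∧ c'.pc = b + 4 ∧
      LoopState v y w e s N K i c2 c' := by
    intro i
    induction i with
    | zero => exact fun _ => ⟨c2, .refl, p2', hl0⟩
    | succ i ih =>
      intro hi
      obtain ⟨c3, r3, p3, q3⟩ := ih (by omega)
      obtain ⟨c4, r4, p4, q4⟩ := loop_round hy hM (by omega) hN (by omega) hP2 hP3 hP4 hP5 hP6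
        p3 q3
      exact ⟨c4, r3.trans r4, p4, q4⟩
  obtain ⟨c3, r3, p3, q3⟩ := loop N le_rfl
  have hacc : c3.reg (2*s+5) ≤ B * y.bd (M + B) := by
    rw [q3.acc]
    refine (Finset.sum_le_card_nsmul _ _ (y.bd (M + B)) fun j hj => ?_).trans ?_
    · exact y.eval_le_bd _ _ _ (update_le hM v (by have := Finset.mem_range.1 hj; omega))
    · simp only [Finset.card_range, smul_eq_mul]
      exact Nat.mul_le_mul_right _ (by omega)
  have hreg : c3.reg (2*v) = N := by simp [q3.vars]
  have r4 := reaches_instr (w := w) (c := c3) (p3 ▸ hP2.1)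
  have p4 : (exec w c3 (.sub (2*s+7) (2*s+1) (2*v))).pc = b + 5 := by
    simp [exec, Instr.effect, p3]
  have hr4 : ∀ u, (exec w c3 (.sub (2*s+7) (2*s+1) (2*v))).reg u =
      if u = 2*s+7 then 0 else c3.reg u := by
    intro u
    simp [exec, Instr.effect, Function.update_apply, hreg, q3.bound]
  have ht4 : (exec w c3 (.sub (2*s+7) (2*s+1) (2*v))).clock ≤ c3.clock + 1 + 2 * B := by
    have := size_le_self N
    simp only [exec, Instr.cost, q3.bound, hreg]
    omega
  have ho4 : (exec w c3 (.sub (2*s+7) (2*s+1) (2*v))).outputs = c3.outputs := rfl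
  generalize exec w c3 (.sub (2*s+7) (2*s+1) (2*v)) = c4 at *
  have r5 := reaches_instr (w := w) (c := c4) (p4 ▸ hP3.1)
  have hz : c4.reg (2*s+7) = 0 := by simp [hr4]
  have p5 : (exec w c4 (.jz (2*s+7) (m+5))).pc = m + 5 := by simp [exec, Instr.effect, hz]
  have ht5 : (exec w c4 (.jz (2*s+7) (m+5))).clock = c4.clock + 1 := by
    simp [exec, Instr.cost, hz]
  have hr5 : (exec w c4 (.jz (2*s+7) (m+5))).reg = c4.reg := rfl
  have ho5 : (exec w c4 (.jz (2*s+7) (m+5))).outputs = c4.outputs := rfl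
  generalize exec w c4 (.jz (2*s+7) (m+5)) = c5 at *
  obtain ⟨r6, p6⟩ := reaches_straight (w := w) (by simp [Instr.straight]) (p5 ▸ hP7)
  have g3 : c3.reg (2*s+3) = e v := q3.saved
  refine ⟨_, r1.trans (r2.trans (r3.trans (r4.trans (r5.trans r6)))), ?_, ?_, ?_, ?_, ?_, ?_⟩
  · rw [p6, p5]
    simp [code, hb]
    omega
  · have h1 : 2 * s + 5 ≠ 2 * v := by omega
    simp [exec, Instr.effect, Function.update_apply, hr5, hr4, q3.acc, eval, hNN, h1]
    intro h; omega
  · intro u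
    have h1 : 2 * u ≠ 2 * s + 1 := by omega
    have h2 : 2 * u ≠ 2 * s + 7 := by omega
    have h3 : 2 * s + 7 ≠ 2 * v := by omega
    simp [exec, Instr.effect, Function.update_apply, hr5, hr4, q3.vars, g3, h1, h2]
    grind
  · intro u hu
    have h1 : 2 * u + 1 ≠ 2 * s + 1 := by omega
    have h2 : 2 * u + 1 ≠ 2 * s + 7 := by omega
    have h3 : 2 * u + 1 ≠ 2 * v := by omega
    have g := ((q3.temps u hu).trans (hq2 u hu)).trans (q1.temps u hu)
    have h4 : u ≠ s := by omega
    have h5 : 2 * u ≠ 2 * s + 6 := by omega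
    simp [exec, Instr.effect, Function.update_apply, hr5, hr4, h3, g, h4, h5]
  · change c5.outputs = _
    rw [ho5, ho4, q3.outs, ho2, q1.outs, ← runOps_append]
    simp [ops, hNN]
  · have h1 : 2 * v ≠ 2 * s + 7 := by omega
    have h2 : 2 * s + 5 ≠ 2 * v := by omega
    have h3 : 2 * s + 7 ≠ 2 * v := by omega
    have h4 := q1.time
    have h5 := q3.time
    have h6 := size_le_self (c3.reg (2*s+5))
    have h7 := size_le_self (e v)
    have h8 := hM v
    have h9 : N * K ≤ B * K := Nat.mul_le_mul_right _ hN
    simp [exec, Instr.effect, Instr.cost, hr5, hr4, g3, h2, h3, ht5]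
    simp only [cost, ← hB, ← hK]
    omega

theorem correct (t : Tm) : t.Correct := by
  induction t with
  | var v => exact correct_var v
  | const c => exact correct_const c
  | bin o x y hx hy => exact correct_bin o x y hx hy
  | read x hx => exact correct_read x hx
  | sum v x y hx hy => exact correct_sum v x y hx hy
  | cond x y hx hy => exact correct_cond x y hx hy
  | write l => exact correct_write l
  | emit => exact correct_emit

end Tm

/-! ### Polynomial bounds for values and running times. -/

/-- Functions bounded by a polynomial. -/
def PolyBdd (f : ℕ → ℕ) : Prop := ∃ p : Polynomial ℕ, ∀ n, f n ≤ p.eval n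

namespace PolyBdd

theorem const (c : ℕ) : PolyBdd fun _ => c := ⟨.C c, by simp⟩

theorem id : PolyBdd fun n => n := ⟨.X, by simp⟩

theorem add {f g : ℕ → ℕ} (hf : PolyBdd f) (hg : PolyBdd g) : PolyBdd fun n => f n + g n := by
  obtain ⟨p, hp⟩ := hf
  obtain ⟨q, hq⟩ := hg
  exact ⟨p + q, fun n => by rw [Polynomial.eval_add]; exact Nat.add_le_add (hp n) (hq n)⟩

theorem mul {f g : ℕ → ℕ} (hf : PolyBdd f) (hg : PolyBdd g) : PolyBdd fun n => f n * g n := by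
  obtain ⟨p, hp⟩ := hf
  obtain ⟨q, hq⟩ := hg
  exact ⟨p * q, fun n => by rw [Polynomial.eval_mul]; exact Nat.mul_le_mul (hp n) (hq n)⟩

/-- The coefficients are natural numbers, so no term decreases. -/
theorem eval_mono (p : Polynomial ℕ) : Monotone fun n => p.eval n := by
  intro a b h
  simp only [Polynomial.eval_eq_sum]
  exact Finset.sum_le_sum fun i _ => Nat.mul_le_mul_left _ (Nat.pow_le_pow_left h i)

theorem comp {f g : ℕ → ℕ} (hf : PolyBdd f) (hg : PolyBdd g) : PolyBdd fun n => f (g n) := by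
  obtain ⟨p, hp⟩ := hf
  obtain ⟨q, hq⟩ := hg
  refine ⟨p.comp q, fun n => ?_⟩
  rw [Polynomial.eval_comp]
  exact (hp _).trans (eval_mono p (hq n))

end PolyBdd

namespace Tm

/-- Rounds of a loop pass nothing to each other except through the sum, so each constructor only
adds, multiplies or composes bounds. Assignments inside loops would allow repeated squaring and
destroy this. -/
theorem bd_polyBdd (t : Tm) : PolyBdd t.bd := by
  induction t with
  | var => exact .id
  | const | read | write | emit => exact .const _
  | bin o x y hx hy => exact (hx.add hy).add (hx.mul hy)
  | sum v x y hx hy => exact hx.mul (hy.comp (PolyBdd.id.add hx))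
  | cond x y _ hy => exact hy

theorem cost_polyBdd (t : Tm) : PolyBdd t.cost := by
  induction t with
  | var => exact PolyBdd.id.add (.const _)
  | const | write | emit => exact .const _
  | bin o x y hx hy =>
    exact (hx.add hy).add (((PolyBdd.const 1).add x.bd_polyBdd).add y.bd_polyBdd)
  | read x hx => exact hx.add ((PolyBdd.const 1).add x.bd_polyBdd)
  | cond x y hx hy => exact (hx.add ((PolyBdd.const 1).add x.bd_polyBdd)).add hy
  | sum v x y hx hy =>
    have hB := x.bd_polyBdd
    have hMB := PolyBdd.id.add hB
    have hC := y.bd_polyBdd.comp hMB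
    exact ((hx.add ((PolyBdd.const 5).add .id)).add (hB.mul ((hy.comp hMB).add
      ((((PolyBdd.const 10).add ((PolyBdd.const 4).mul hB)).add (hB.mul hC)).add hC)))).add
      ((((PolyBdd.const 10).add ((PolyBdd.const 3).mul hB)).add .id).add (hB.mul hC))

end Tm

/-! ### From programs to machines with polynomial time and delay. -/

/-- Computing the length of the input into register `0`. -/
def lengthCode : List Instr :=
  [.const 3 1, .read 1 0, .jz 1 6, .add 0 0 3, .const 1 0, .jz 1 1]

/-- The initial values of the variables: variable `0` holds the length of the input. -/
def env₀ (w : Word) : ℕ → ℕ := fun i => if i = 0 then w.length else 0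

/-- All letters have nonzero codes, so reading `0` detects the end of the input. -/
theorem inputAt_eq_zero {w : Word} {p : ℕ} : inputAt w p = 0 ↔ w.length ≤ p := by
  unfold inputAt
  split
  · rename_i h
    simpa using h
  · rename_i a h
    obtain ⟨h', -⟩ := List.getElem?_eq_some_iff.1 h
    cases a <;> simpa [Letter.code] using h'

theorem lengthCode_run {P : List Instr} (w : Word) (h : CodeAt P 0 lengthCode) :
    ∃ c, StateTransition.Reaches (step P w) initConfig c ∧ c.pc = 6 ∧
      (∀ i, c.reg (2*i) = env₀ w i) ∧ c.outputs = ([], []) ∧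
      c.clock ≤ 10 * (w.length + 1) * (w.length + 1) := by
  obtain ⟨h0, h1, h2, h3, h4, h5, -⟩ := h
  -- Register `0` counts the letters read and register `3` keeps the constant `1`. The registers `1`
  -- and `3` are odd, so no variable is disturbed.
  have loop : ∀ i ≤ w.length, ∃ c, StateTransition.Reaches (step P w) initConfig c ∧ c.pc = 1 ∧
      c.reg 0 = i ∧ c.reg 3 = 1 ∧ (∀ j, j ≠ 0 → c.reg (2*j) = 0) ∧ c.outputs = ([], []) ∧
      c.clock ≤ 2 + i * (10 + 2 * w.length) := by
    intro i
    induction i with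
    | zero =>
      intro _
      refine ⟨_, reaches_instr h0, rfl, rfl, rfl, fun j hj => ?_, rfl, by
        simp [exec, initConfig, Instr.cost]⟩
      simp [exec, Instr.effect, initConfig, Function.update_apply]
      omega
    | succ i ih =>
      intro hi
      obtain ⟨c, r, hp, hr0, hr3, hrj, ho, ht⟩ := ih (by omega)
      obtain ⟨r1, p1⟩ := reaches_straight (P := P) (w := w) (c := c) (l := [.read 1 0])
        (by simp [Instr.straight]) (by rw [hp]; exact ⟨h1, trivial⟩)
      rw [hp] at p1
      simp only [List.foldl_cons, List.foldl_nil, List.length_cons, List.length_nil] at r1 p1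
      have r2 := reaches_instr (w := w) (c := exec w c (.read 1 0)) (i := .jz 1 6)
        (by rw [p1]; exact h2)
      have hne : inputAt w i ≠ 0 := by rw [Ne, inputAt_eq_zero]; omega
      have hs := (size_le_self _).trans (inputAt_le w i)
      have hsi := size_le_self i
      have p2 : (exec w (exec w c (.read 1 0)) (.jz 1 6)).pc = 3 := by
        simp [exec, Instr.effect, hr0, hne, hp]
      obtain ⟨r3, p3⟩ := reaches_straight (P := P) (w := w)
        (c := exec w (exec w c (.read 1 0)) (.jz 1 6)) (l := [.add 0 0 3, .const 1 0])
        (by simp [Instr.straight]) (by rw [p2]; exact ⟨h3, h4, trivial⟩)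
      have r4 := reaches_instr (w := w) (c := List.foldl (exec w)
        (exec w (exec w c (.read 1 0)) (.jz 1 6)) [.add 0 0 3, .const 1 0]) (i := .jz 1 1)
        (by rw [p3, p2]; exact h5)
      refine ⟨_, r.trans (r1.trans (r2.trans (r3.trans r4))), ?_, ?_, ?_, ?_, ?_, ?_⟩
      · simp [exec, Instr.effect]
      · simp [exec, Instr.effect, hr0, hr3]
      · simp [exec, Instr.effect, hr3]
      · intro j hj
        have h6 : 2 * j ≠ 1 := by omega
        simp [exec, Instr.effect, hj, hrj j hj, h6]
      · exact ho
      · simp [exec, Instr.effect, Instr.cost, hr0, hr3, Nat.add_mul]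
        omega
  obtain ⟨c, r, hp, hr0, hr3, hrj, ho, ht⟩ := loop w.length le_rfl
  have r1 := reaches_instr (w := w) (c := c) (i := .read 1 0) (by rw [hp]; exact h1)
  have hz : inputAt w w.length = 0 := inputAt_eq_zero.2 le_rfl
  have hs := size_le_self w.length
  have r2 := reaches_instr (w := w) (c := exec w c (.read 1 0)) (i := .jz 1 6)
    (by simpa [exec, Instr.effect, hp] using h2)
  refine ⟨_, r.trans (r1.trans r2), ?_, ?_, ?_, ?_⟩
  · simp [exec, Instr.effect, hr0, hz]
  · intro i
    have h6 : 2 * i ≠ 1 := by omega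
    by_cases hi : i = 0
    · simp [exec, Instr.effect, env₀, hi, hr0]
    · simp [exec, Instr.effect, env₀, hi, hrj i hi]
  · exact ho
  · simp only [exec, Instr.effect, Instr.cost, hr0, hz, Function.update_self, Nat.size_zero]
    nlinarith

/-- With this, a bound on the total time bounds the time of every output. -/
theorem reaches_times {P : List Instr} {w : Word} {c : Config}
    (h : StateTransition.Reaches (step P w) initConfig c) : ∀ e ∈ c.out, e.1 ≤ c.clock := by
  induction h with
  | refl => simp [initConfig]
  | @tail b c _ h ih =>
    simp only [step] at h
    split at h
    · simp at h
    · rename_i i _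
      simp only [Option.mem_def, Option.some.injEq] at h
      subst h
      intro e he
      cases i <;> simp only [Instr.effect, List.mem_append, List.mem_singleton] at he <;>
        (try (exact (ih e he).trans (Nat.le_add_right _ _)))
      rcases he with he | rfl
      · exact (ih e he).trans (Nat.le_add_right _ _)
      · simp [Instr.cost]

/-- Every program of the language runs on a machine in polynomial time. -/
theorem Tm.exists_machine (t : Tm) : ∃ (P : List Instr) (p : Polynomial ℕ), ∀ w : Word,
    ∃ c : Config, HaltsAt P w c ∧
      c.out.map Prod.snd = (runOps (t.ops w (env₀ w)) ([], [])).2 ∧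
      c.clock ≤ p.eval w.length ∧ ∀ e ∈ c.out, e.1 ≤ c.clock := by
  obtain ⟨p, hp⟩ := (((PolyBdd.const 10).mul (PolyBdd.id.add (.const 1))).mul
    (PolyBdd.id.add (.const 1))).add t.cost_polyBdd
  refine ⟨lengthCode ++ t.code 6 0, p, fun w => ?_⟩
  have hP0 : CodeAt (lengthCode ++ t.code 6 0) 0 lengthCode :=
    (codeAt_append.1 (codeAt_self [] (lengthCode ++ t.code 6 0))).1
  obtain ⟨c, r, hpc, hr, ho, ht⟩ := lengthCode_run w hP0
  obtain ⟨c', r', hpc', q⟩ := t.correct _ w 6 0 c (env₀ w) w.length (codeAt_self lengthCode (t.code 6 0)) hpc hr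
    (by intro i; unfold env₀; split_ifs <;> omega)
  refine ⟨c', ?_, ?_, ?_, reaches_times (r.trans r')⟩
  · refine StateTransition.mem_eval.2 ⟨r.trans r', ?_⟩
    have : (lengthCode ++ t.code 6 0)[c'.pc]? = none := by
      simp [hpc', lengthCode]; omega
    simp [step, this]
  · have := congrArg Prod.snd q.outs
    rwa [ho] at this
  · exact (q.time.trans (Nat.add_le_add_right ht _)).trans (hp _)

/-- Writing the word `y`. -/
def writes (y : Word) : Ops := y.map some

/-- Outputting the words of a list. -/
def outputs (l : List Word) : Ops := l.flatMap fun y => writes y ++ [none]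

theorem runOps_writes (y b : Word) (l : List Word) : runOps (writes y) (b, l) = (b ++ y, l) := by
  induction y generalizing b with
  | nil => simp [writes]
  | cons a y ih =>
    have := ih (b ++ [a])
    simpa [writes, runOps] using this

theorem runOps_outputs (l l' : List Word) : runOps (outputs l) ([], l') = ([], l' ++ l) := by
  induction l generalizing l' with
  | nil => simp [outputs]
  | cons y l ih =>
    have h : outputs (y :: l) = writes y ++ ([none] ++ outputs l) := by simp [outputs]
    rw [h, runOps_append, runOps_writes, runOps_append]
    have := ih (l' ++ [y])
    simpa [runOps] using this

theorem Tm.polyTime (t : Tm) (f : Word → Word) (h : ∀ w, t.ops w (env₀ w) = outputs [f w]) :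
    PolyTime f := by
  obtain ⟨P, p, hP⟩ := t.exists_machine
  refine ⟨P, p, fun w => ?_⟩
  obtain ⟨c, h1, h2, h3, -⟩ := hP w
  exact ⟨c, h1, by rw [h2, h, runOps_outputs]; rfl, h3⟩

theorem isChain_of_forall_le {l : List ℕ} {m a : ℕ} (h : ∀ x ∈ l, x ≤ m) :
    List.IsChain (fun s t => t ≤ s + m) (a :: l) := by
  induction l generalizing a with
  | nil => simp
  | cons b l ih =>
    simp only [List.isChain_cons_cons]
    exact ⟨(h b (by simp)).trans (by omega), ih fun x hx => h x (by simp [hx])⟩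

/-- Each gap is at most the total running time. This suffices here because the problems `C` of both
reductions have only polynomially many solutions on each input. -/
theorem Tm.delayP (t : Tm) (l : Word → List Word) (h : ∀ w, t.ops w (env₀ w) = outputs (l w))
    (hl : ∀ w, (l w).Nodup) : DelayP fun w => {y | y ∈ l w} := by
  obtain ⟨P, p, hP⟩ := t.exists_machine
  refine ⟨P, p, fun w => ?_⟩
  obtain ⟨c, h1, h2, h3, h4⟩ := hP w
  rw [h, runOps_outputs, List.nil_append] at h2
  refine ⟨c, h1, by rw [h2]; exact hl w, by rw [h2], isChain_of_forall_le ?_⟩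
  intro x hx
  simp only [List.mem_append, List.mem_map, List.mem_singleton] at hx
  rcases hx with ⟨e, he, rfl⟩ | rfl
  · exact (h4 e he).trans h3
  · exact h3

end EnumRed

namespace EnumRed

/-! ### The closure and the independent sets. -/

section Closure

variable {n k : ℕ} {S : Set (Fin n → Bool)}

theorem threshold_mem_S12 (k : ℕ) : threshold k (k + 1) ∈ S12 k :=
  CloneMem.comp _ (Or.inl rfl) _ fun i => .proj i

theorem andImp_mem_S12 (k : ℕ) : andImp ∈ S12 k :=
  CloneMem.comp _ (Or.inr rfl) _ fun i => .proj i

/-- A set of vectors closed under the generators of a clone is closed under the clone. -/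
theorem cl_clone_subset {D : Type} {F : Set (Operation D)} {S X : Set (Fin n → D)} (hS : S ⊆ X)
    (hX : ∀ f ∈ F, ∀ v : Fin f.1 → Fin n → D, (∀ j, v j ∈ X) → (fun i => f.2 fun j => v j i) ∈ X) :
    Cl (clone F) S ⊆ X := by
  have key : ∀ (t : ℕ) (f : (Fin t → D) → D), CloneMem F t f → ∀ v : Fin t → Fin n → D,
      (∀ j, v j ∈ X) → (fun i => f fun j => v j i) ∈ X := by
    intro t f hf v hv
    induction hf with
    | proj i => exact hv i
    | comp f hf g _ ih => exact hX _ hf _ fun i => ih i v hv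
  intro u hu
  induction hu with
  | base v hv => exact hS hv
  | app f hf v _ ih => exact key _ _ hf v ih

theorem cl_S12_subset {X : Set (Fin n → Bool)} (hS : S ⊆ X)
    (h₁ : ∀ v : Fin (k + 1) → Fin n → Bool, (∀ j, v j ∈ X) →
      (fun i => decide (k ≤ (Finset.univ.filter fun j => v j i = true).card)) ∈ X)
    (h₂ : ∀ x ∈ X, ∀ y ∈ X, ∀ z ∈ X, (fun i => x i && (!(y i) || z i)) ∈ X) :
    Cl (S12 k) S ⊆ X := by
  refine cl_clone_subset hS ?_
  rintro f (rfl | rfl) v hv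
  · exact h₁ v hv
  · exact h₂ _ (hv (0 : Fin 3)) _ (hv (1 : Fin 3)) _ (hv (2 : Fin 3))

theorem cl_threshold {v : Fin (k + 1) → Fin n → Bool} (hv : ∀ j, v j ∈ Cl (S12 k) S) :
    (fun i => decide (k ≤ (Finset.univ.filter fun j => v j i = true).card)) ∈ Cl (S12 k) S :=
  Cl.app _ (threshold_mem_S12 k) v hv

theorem cl_andImp {x y z : Fin n → Bool} (hx : x ∈ Cl (S12 k) S) (hy : y ∈ Cl (S12 k) S)
    (hz : z ∈ Cl (S12 k) S) : (fun i => x i && (!(y i) || z i)) ∈ Cl (S12 k) S :=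
  Cl.app andImp (andImp_mem_S12 k) ![x, y, z] fun j => by
    fin_cases j <;> assumption

/-- Conjunction is `x ∧ (x → y)`. -/
theorem cl_and {x y : Fin n → Bool} (hx : x ∈ Cl (S12 k) S) (hy : y ∈ Cl (S12 k) S) :
    (fun i => x i && y i) ∈ Cl (S12 k) S := by
  convert cl_andImp hx hx hy using 2 with i
  cases x i <;> simp

/-- Coordinates that are `1` in all vectors. -/
def IsOne (S : Set (Fin n → Bool)) (i : Fin n) : Prop := ∀ u ∈ S, u i = true

/-- Coordinates that agree in all vectors. -/
def Twins (S : Set (Fin n → Bool)) (i j : Fin n) : Prop := ∀ u ∈ S, u i = u j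

theorem Twins.refl (i : Fin n) : Twins S i i := fun _ _ => rfl

theorem Twins.symm {i j : Fin n} (h : Twins S i j) : Twins S j i := fun u hu => (h u hu).symm

theorem Twins.trans {i j l : Fin n} (h : Twins S i j) (h' : Twins S j l) : Twins S i l :=
  fun u hu => (h u hu).trans (h' u hu)

/-- Both generators take the value `1` when all arguments are `1`. -/
theorem cl_isOne {i : Fin n} (h : IsOne S i) {v : Fin n → Bool}
    (hv : v ∈ Cl (S12 k) S) : v i = true := by
  refine cl_S12_subset (X := {v | v i = true}) (fun u hu => h u hu) ?_ ?_ hv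
  · intro v hv
    simp only [Set.mem_ofPred_eq] at hv ⊢
    simp [hv]
  · intro x hx y hy z hz
    simp_all

theorem cl_twins {i j : Fin n} (h : Twins S i j) {v : Fin n → Bool}
    (hv : v ∈ Cl (S12 k) S) : v i = v j := by
  refine cl_S12_subset (X := {v | v i = v j}) (fun u hu => h u hu) ?_ ?_ hv
  · intro v hv
    simp only [Set.mem_ofPred_eq] at hv ⊢
    simp [hv]
  · intro x hx y hy z hz
    simp_all

@[simp] theorem charVec_apply {T : Set (Fin n)} {i : Fin n} : charVec T i = true ↔ i ∈ T := by
  simp [charVec]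

@[simp] theorem charVec_setOf (v : Fin n → Bool) : charVec {i | v i = true} = v := by
  ext i
  simp [charVec]

@[simp] theorem charVec_univ : charVec (Set.univ : Set (Fin n)) = fun _ => true :=
  funext fun _ => charVec_apply.2 trivial

theorem charVec_injective : Function.Injective (charVec (n := n)) := by
  intro T T' h
  ext i
  rw [← charVec_apply, h, charVec_apply]

theorem charVec_le {T T' : Set (Fin n)} : charVec T ≤ charVec T' ↔ T ⊆ T' := by
  refine ⟨fun h i hi => ?_, fun h i hi => ?_⟩
  · have := h i (charVec_apply.2 hi)
    simpa using this
  · have : charVec T i = true := hi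
    rw [charVec_apply] at this
    exact charVec_apply.2 (h this)

theorem indep_coHypergraph {T : Set (Fin n)} :
    Indep (coHypergraph k S) T ↔
      ∀ I ⊆ T, I.ncard ≤ k → ∃ u ∈ S, ∀ i ∈ I, u i = true := by
  constructor
  · intro h I hI hc
    by_contra! h'
    refine h.2 I ⟨hc, fun u hu hall => ?_⟩ hI
    obtain ⟨i, hi, hne⟩ := h' u hu
    exact hne (hall i hi)
  · intro h
    refine ⟨Set.subset_univ _, fun I hI hT => ?_⟩
    obtain ⟨u, hu, h'⟩ := h I hT hI.1
    exact hI.2 u hu h'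

theorem Indep.mono {V : Type} {H : Hypergraph V} {T T' : Set V} (h : Indep H T') (hT : T ⊆ T') :
    Indep H T :=
  ⟨hT.trans h.1, fun e he hs => h.2 e he (hs.trans hT)⟩

/-- For a hyperedge `I`, the property of having a `0` in `I` holds on `S` and is preserved by the
generators. -/
theorem indep_of_mem_cl {v : Fin n → Bool} (hk : 1 ≤ k) (hv : v ∈ Cl (S12 k) S) :
    Indep (coHypergraph k S) {i | v i = true} := by
  refine ⟨Set.subset_univ _, fun I hI hT => ?_⟩
  have : ∃ i ∈ I, v i = false := by
    refine cl_S12_subset (X := {v | ∃ i ∈ I, v i = false}) (fun u hu => ?_) ?_ ?_ hv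
    · have := hI.2 u hu
      simpa using this
    · intro v hv
      choose f hf hv using hv
      -- Pigeonhole: `k + 1` vectors choose zeros among at most `k` positions. Two zeros at the same
      -- position leave at most `k - 1` ones there, below the threshold.
      obtain ⟨a, b, hab, he⟩ : ∃ a b, a ≠ b ∧ f a = f b := by
        have hc : (I.toFinite.toFinset).card < (Finset.univ : Finset (Fin (k+1))).card := by
          rw [Finset.card_univ, Fintype.card_fin, ← Set.ncard_eq_toFinset_card]
          exact Nat.lt_succ_of_le hI.1
        obtain ⟨a, -, b, -, h⟩ := Finset.exists_ne_map_eq_of_card_lt_of_maps_to hc (f := f)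
          (fun x _ => by simpa using hf x)
        exact ⟨a, b, h⟩
      refine ⟨f a, hf a, ?_⟩
      have hsub : (Finset.univ.filter fun j => v j (f a) = true) ⊆
          Finset.univ \ {a, b} := by
        intro j hj
        simp only [Finset.mem_filter, Finset.mem_univ, true_and] at hj
        simp only [Finset.mem_sdiff, Finset.mem_univ, true_and, Finset.mem_insert,
          Finset.mem_singleton, not_or]
        constructor
        · rintro rfl
          simp [hv] at hj
        · rintro rfl
          rw [he] at hj
          simp [hv] at hj
      have hcard := Finset.card_le_card hsub
      rw [Finset.card_sdiff_of_subset (Finset.subset_univ _), Finset.card_pair hab,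
        Finset.card_univ, Fintype.card_fin] at hcard
      simp only [decide_eq_false_iff_not]
      omega
    · rintro x ⟨i, hi, hx⟩ y - z -
      exact ⟨i, hi, by simp [hx]⟩
  obtain ⟨i, hi, h⟩ := this
  have := hT hi
  simp_all

/-- The conjunction of all vectors. -/
theorem charVec_isOne_mem_cl (hS : S.Nonempty) : charVec {i | IsOne S i} ∈ Cl (S12 k) S := by
  have key : ∀ A : Finset (Fin n → Bool), A.Nonempty → (∀ u ∈ A, u ∈ S) →
      charVec {i | ∀ u ∈ A, u i = true} ∈ Cl (S12 k) S := by
    intro A hA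
    induction hA using Finset.Nonempty.cons_induction with
    | singleton a =>
      intro h
      simp only [Finset.mem_singleton, forall_eq, charVec_setOf]
      exact Cl.base a (h a (by simp))
    | cons a A ha hA ih =>
      intro h
      have := cl_and (Cl.base (F := S12 k) a (h a (by simp))) (ih fun u hu => h u (by simp [hu]))
      convert this using 1
      ext i
      rw [Bool.eq_iff_iff]
      simp
  have := key S.toFinite.toFinset (by simpa using hS) (by simp)
  simpa [IsOne] using this

/-- Sets between the constant coordinates and a vector of the closure, that do not separate
coordinates that agree, give vectors of the closure. -/
theorem cl_of_le {u : Fin n → Bool} (hS : S.Nonempty) (hu : u ∈ Cl (S12 k) S) {T : Set (Fin n)}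
    (hone : ∀ i, IsOne S i → i ∈ T) (htw : ∀ i j, Twins S i j → i ∈ T → j ∈ T)
    (hle : ∀ i ∈ T, u i = true) : charVec T ∈ Cl (S12 k) S := by
  classical
  -- relative complement
  have hb := charVec_isOne_mem_cl (k := k) hS
  have compl : ∀ x ∈ Cl (S12 k) S,
      charVec {i | u i = true ∧ (x i = false ∨ IsOne S i)} ∈ Cl (S12 k) S := by
    intro x hx
    convert cl_andImp hu hx hb using 1
    ext i
    simp [charVec]
  -- De Morgan in the interval from the conjunction of all vectors to `u`, where `compl` is the
  -- complement.
  have union : ∀ x ∈ Cl (S12 k) S, ∀ y ∈ Cl (S12 k) S, x ≤ u → y ≤ u →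
      (fun i => x i || y i) ∈ Cl (S12 k) S := by
    intro x hx y hy hxu hyu
    have := compl _ (cl_and (compl x hx) (compl y hy))
    convert this using 1
    ext i
    have h1 : x i = true → u i = true := hxu i
    have h2 : y i = true → u i = true := hyu i
    have h3 : IsOne S i → x i = true := fun h => cl_isOne h hx
    have h4 : IsOne S i → u i = true := fun h => cl_isOne h hu
    simp only [charVec]
    cases hxi : x i <;> cases hyi : y i <;> cases hui : u i <;> by_cases hi : IsOne S i <;>
      simp_all
  -- separating two coordinates
  have sep : ∀ i ∈ T, ∀ j, u j = true → j ∉ T →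
      ∃ x ∈ Cl (S12 k) S, x ≤ u ∧ x i = true ∧ x j = false := by
    intro i hi j huj hj
    have hnt : ¬ Twins S i j := fun h => hj (htw i j h hi)
    simp only [Twins, not_forall] at hnt
    obtain ⟨w, hw, hne⟩ := hnt
    have hwc := Cl.base (F := S12 k) w hw
    -- Some `w ∈ S` distinguishes `i` from `j`. If `w i = 1`, meet it with `u`; if `w i = 0`, its
    -- complement relative to `u` serves, and it vanishes at `j` because `j ∉ T` is not constant.
    cases hwi : w i
    · have hwj : w j = true := by
        rw [hwi] at hne
        simpa using Ne.symm hne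
      refine ⟨_, compl w hwc, ?_, ?_, ?_⟩
      · intro l hl
        have : charVec {i | u i = true ∧ (w i = false ∨ IsOne S i)} l = true := hl
        rw [charVec_apply] at this
        exact this.1
      · simp [hwi, hle i hi]
      · have hjo : ¬ IsOne S j := fun h => hj (hone j h)
        simp [charVec, hwj, hjo]
    · have hwj : w j = false := by
        rw [hwi] at hne
        simpa using Ne.symm hne
      refine ⟨_, cl_and hu hwc, fun l => ?_, ?_, ?_⟩
      · simp only
        cases u l <;> simp
      · simp [hwi, hle i hi]
      · simp [hwj]
  -- a vector below `T`, that contains a given element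
  have below : ∀ i ∈ T, ∃ x ∈ Cl (S12 k) S, x ≤ u ∧ x i = true ∧ ∀ j, x j = true → j ∈ T := by
    intro i hi
    have : ∀ A : Finset (Fin n), (∀ j ∈ A, u j = true ∧ j ∉ T) →
        ∃ x ∈ Cl (S12 k) S, x ≤ u ∧ x i = true ∧ ∀ j ∈ A, x j = false := by
      intro A
      induction A using Finset.induction_on with
      | empty => exact fun _ => ⟨u, hu, le_rfl, hle i hi, by simp⟩
      | insert a A ha ih =>
        intro h
        obtain ⟨x, hx, hxu, hxi, hxA⟩ := ih fun j hj => h j (by simp [hj])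
        obtain ⟨y, hy, -, hyi, hya⟩ := sep i hi a (h a (by simp)).1 (h a (by simp)).2
        refine ⟨_, cl_and hx hy, fun l => ?_, by simp [hxi, hyi], ?_⟩
        · refine le_trans ?_ (hxu l)
          simp only
          cases x l <;> simp
        · intro j hj
          rcases Finset.mem_insert.1 hj with rfl | hj
          · simp [hya]
          · simp [hxA j hj]
    obtain ⟨x, hx, hxu, hxi, hxA⟩ := this (Finset.univ.filter fun j => u j = true ∧ j ∉ T)
      (by simp)
    refine ⟨x, hx, hxu, hxi, fun j hj => ?_⟩
    by_contra hjT
    have := hxA j (by simpa using ⟨hxu j hj, hjT⟩)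
    simp [hj] at this
  -- `T` is the union of the vectors just found; the empty union is the conjunction of all vectors,
  -- whose ones lie in `T` by `hone`.
  have : ∀ A : Finset (Fin n), (∀ i ∈ A, i ∈ T) →
      ∃ x ∈ Cl (S12 k) S, x ≤ u ∧ (∀ i ∈ A, x i = true) ∧ ∀ j, x j = true → j ∈ T := by
    intro A
    induction A using Finset.induction_on with
    | empty =>
      refine fun _ => ⟨_, hb, fun i hi => ?_, by simp, fun j hj => ?_⟩
      · have hi' : charVec {i | IsOne S i} i = true := hi
        rw [charVec_apply] at hi'
        exact cl_isOne hi' hu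
      · exact hone j (charVec_apply.1 hj)
    | insert a A ha ih =>
      intro h
      obtain ⟨x, hx, hxu, hxA, hxT⟩ := ih fun j hj => h j (by simp [hj])
      obtain ⟨y, hy, hyu, hya, hyT⟩ := below a (h a (by simp))
      refine ⟨_, union x hx y hy hxu hyu, fun l hl => ?_, ?_, ?_⟩
      · rcases Bool.or_eq_true_iff.1 hl with hl | hl
        · exact hxu l hl
        · exact hyu l hl
      · intro i hi
        rcases Finset.mem_insert.1 hi with rfl | hi
        · simp [hya]
        · simp [hxA i hi]
      · intro j hj
        rcases Bool.or_eq_true_iff.1 hj with hj | hj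
        · exact hxT j hj
        · exact hyT j hj
  obtain ⟨x, hx, -, hxA, hxT⟩ := this (Finset.univ.filter (· ∈ T)) (by simp)
  convert hx using 1
  ext i
  rw [Bool.eq_iff_iff, charVec_apply]
  exact ⟨fun h => hxA i (by simpa using h), hxT i⟩

/-- Independent sets that contain the constant coordinates and do not separate coordinates that
agree give vectors of the closure. -/
theorem cl_of_indep (hk : 1 ≤ k) (hS : S.Nonempty) {T : Set (Fin n)}
    (hT : Indep (coHypergraph k S) T)
    (hone : ∀ i, IsOne S i → i ∈ T) (htw : ∀ i j, Twins S i j → i ∈ T → j ∈ T) :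
    charVec T ∈ Cl (S12 k) S := by
  classical
  induction hm : T.ncard using Nat.strong_induction_on generalizing T with
  | _ m ih =>
  subst hm
  -- The column of a coordinate, made `0` outside `S`, is a code of its twin class.
  let φ : Fin n → (Fin n → Bool) → Bool := fun i u => decide (u ∈ S) && u i
  have hφ : ∀ i j, φ i = φ j ↔ Twins S i j := by
    intro i j
    constructor
    · intro h u hu
      have := congrFun h u
      simpa [φ, hu] using this
    · intro h
      ext u
      by_cases hu : u ∈ S
      · simp [φ, hu, h u hu]
      · simp [φ, hu]
  let A : Finset (Fin n) := Finset.univ.filter fun i => i ∈ T ∧ ¬ IsOne S i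
  by_cases hc : (A.image φ).card ≤ k
  · -- few classes
    obtain ⟨I, hIA, hinj, hIim⟩ := Finset.exists_subset_injOn_image_eq_of_surjOn (f := φ)
      (A : Set (Fin n)) (A.image φ) (by simpa using Set.surjOn_image φ A)
    have hIc : I.card ≤ k := by
      rw [← Finset.card_image_of_injOn hinj, hIim]
      exact hc
    obtain ⟨u, hu, hI⟩ := indep_coHypergraph.1 hT I
      (fun i hi => by simpa using (Finset.mem_filter.1 (hIA hi)).2.1) (by simpa using hIc)
    -- `u` is `1` on one representative of each class, hence on all of `T`.
    refine cl_of_le hS (Cl.base u hu) hone htw fun i hi => ?_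
    by_cases hio : IsOne S i
    · exact hio u hu
    · have : φ i ∈ I.image φ := by
        rw [hIim]
        exact Finset.mem_image_of_mem _ (by simp [A, hi, hio])
      obtain ⟨j, hj, he⟩ := Finset.mem_image.1 this
      rw [← (hφ j i).1 he u hu]
      exact hI j hj
  · obtain ⟨B, hBA, hBc⟩ := Finset.exists_subset_card_eq (show k + 1 ≤ (A.image φ).card by omega)
    let b : Fin (k + 1) ≃ B := (B.equivFin.trans (finCongr hBc)).symm
    have hb : ∀ j, ∃ i, i ∈ T ∧ ¬ IsOne S i ∧ φ i = b j := by
      intro j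
      obtain ⟨i, hi, he⟩ := Finset.mem_image.1 (hBA (b j).2)
      exact ⟨i, (Finset.mem_filter.1 hi).2.1, (Finset.mem_filter.1 hi).2.2, he⟩
    choose t ht hto hte using hb
    have hinj : ∀ a c, Twins S (t a) (t c) → a = c := by
      intro a c h
      have := (hφ _ _).2 h
      rw [hte, hte] at this
      exact b.injective (Subtype.ext this)
    -- Removing a whole non-constant class keeps the set compatible and makes it smaller, so the
    -- induction hypothesis applies.
    have hmem : ∀ j, charVec {i | i ∈ T ∧ ¬ Twins S (t j) i} ∈ Cl (S12 k) S := by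
      intro j
      refine ih _ ?_ (hT.mono fun i hi => hi.1) ?_ ?_ rfl
      · refine Set.ncard_lt_ncard ⟨fun i hi => hi.1, fun h => ?_⟩
        exact (h (ht j)).2 (.refl _)
      · intro i hi
        refine ⟨hone i hi, fun h => hto j fun u hu => ?_⟩
        rw [h u hu]
        exact hi u hu
      · intro i l h hi
        exact ⟨htw i l h hi.1, fun h' => hi.2 (h'.trans h.symm)⟩
    have := cl_threshold hmem
    convert this using 1
    ext i
    rw [Bool.eq_iff_iff, charVec_apply, decide_eq_true_iff]
    simp only [charVec_apply, Set.mem_ofPred_eq]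
    constructor
    -- The `k + 1` removed classes are distinct, so `i` is missing from at most one of the sets and
    -- belongs to at least `k`.
    · intro hi
      have h1 : (Finset.univ.filter fun j => Twins S (t j) i).card ≤ 1 := by
        rw [Finset.card_le_one]
        intro a ha c hc
        exact hinj a c ((Finset.mem_filter.1 ha).2.trans (Finset.mem_filter.1 hc).2.symm)
      have h2 := Finset.card_filter_add_card_filter_not (s := (Finset.univ : Finset (Fin (k+1))))
        (fun j => Twins S (t j) i)
      rw [Finset.card_univ, Fintype.card_fin] at h2
      simp only [hi, true_and]
      omega
    -- Conversely, since `k ≥ 1`, the point belongs to at least one of the sets, and all are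
    -- contained in `T`.
    · intro h
      obtain ⟨j, hj⟩ := Finset.card_pos.1 (lt_of_lt_of_le (by omega) h)
      exact (Finset.mem_filter.1 hj).2.1

/-- Replacing `j` by its twin `i` does not enlarge a small set, and a vector of `S` that is `1` on
the new set is `1` on the old one. -/
theorem indep_twin (T : Set (Fin n)) (hT : Maximal (Indep (coHypergraph k S)) T) {i j : Fin n}
    (h : Twins S i j) (hi : i ∈ T) : j ∈ T := by
  classical
  have : Indep (coHypergraph k S) (insert j T) := by
    rw [indep_coHypergraph]
    intro I hI hc
    have h1 : (fun l => if l = j then i else l) '' I ⊆ T := by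
      rintro _ ⟨l, hl, rfl⟩
      by_cases hlj : l = j
      · simpa [hlj] using hi
      · simpa [hlj] using (hI hl).resolve_left hlj
    obtain ⟨u, hu, h2⟩ := indep_coHypergraph.1 hT.prop _ h1
      ((Set.ncard_image_le I.toFinite).trans hc)
    refine ⟨u, hu, fun l hl => ?_⟩
    have := h2 _ ⟨l, hl, rfl⟩
    by_cases hlj : l = j
    · simp only [hlj, if_true] at this ⊢
      rw [← h u hu, this]
    · simpa [hlj] using this
  exact hT.le_of_ge this (Set.subset_insert _ _) (Set.mem_insert _ _)

/-- A constant coordinate can be removed from a small set before looking for a vector that covers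
it. -/
theorem indep_isOne (T : Set (Fin n)) (hT : Maximal (Indep (coHypergraph k S)) T) {i : Fin n}
    (h : IsOne S i) : i ∈ T := by
  have : Indep (coHypergraph k S) (insert i T) := by
    rw [indep_coHypergraph]
    intro I hI hc
    obtain ⟨u, hu, h2⟩ := indep_coHypergraph.1 hT.prop (I ∩ T) Set.inter_subset_right
      ((Set.ncard_le_ncard Set.inter_subset_left).trans hc)
    refine ⟨u, hu, fun l hl => ?_⟩
    rcases hI hl with rfl | hl'
    · exact h u hu
    · exact h2 l ⟨hl, hl'⟩
  exact hT.le_of_ge this (Set.subset_insert _ _) (Set.mem_insert _ _)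

/-- Even the empty subset of `T` has to be covered by a vector: if `S` is empty, the empty set is a
hyperedge. -/
theorem nonempty_of_indep {T : Set (Fin n)} (hT : Indep (coHypergraph k S) T) : S.Nonempty := by
  obtain ⟨u, hu, -⟩ := indep_coHypergraph.1 hT ∅ (Set.empty_subset _) (by simp)
  exact ⟨u, hu⟩

theorem cl_of_maximal_indep (hk : 1 ≤ k) {T : Set (Fin n)}
    (hT : Maximal (Indep (coHypergraph k S)) T) : charVec T ∈ Cl (S12 k) S :=
  cl_of_indep hk (nonempty_of_indep hT.prop) hT.prop (fun _ => indep_isOne T hT)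
    fun _ _ => indep_twin T hT

/-- The closure lies inside the family of independent sets and contains its maximal members; as
every independent set extends to a maximal one, the two families have the same maximal members. -/
theorem maximal_cl (hk : 1 ≤ k) {v : Fin n → Bool} :
    Maximal (fun u => u ∈ Cl (S12 k) S) v ↔
      Maximal (Indep (coHypergraph k S)) {i | v i = true} := by
  constructor
  · intro h
    obtain ⟨T, hT, hmax⟩ := Finite.exists_le_maximal (p := Indep (coHypergraph k S))
      (indep_of_mem_cl hk h.prop)
    have h1 := cl_of_maximal_indep hk hmax
    have h2 : v ≤ charVec T := by
      rw [← charVec_setOf v]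
      exact charVec_le.2 hT
    have h3 := h.eq_of_le h1 h2
    have h4 : {i | v i = true} = T := by
      rw [h3]; ext i; simp
    rwa [h4]
  · intro h
    have h1 := cl_of_maximal_indep hk h
    rw [charVec_setOf] at h1
    refine ⟨h1, fun u hu hle i hi => ?_⟩
    have := h.le_of_ge (indep_of_mem_cl hk hu) (fun i hi => hle i hi)
    exact this hi

theorem cl_eq_image_indep (hk : 1 ≤ k) (h₁ : ∀ i, ∃ u ∈ S, u i = false)
    (h₂ : ∀ i j, i ≠ j → ∃ u ∈ S, u i ≠ u j) :
    Cl (S12 k) S = charVec '' {T | Indep (coHypergraph k S) T} := by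
  ext v
  constructor
  · intro hv
    exact ⟨_, indep_of_mem_cl hk hv, charVec_setOf v⟩
  · rintro ⟨T, hT, rfl⟩
    refine cl_of_indep hk (nonempty_of_indep hT) hT ?_ ?_
    · intro i hi
      obtain ⟨u, hu, h⟩ := h₁ i
      simp [hi u hu] at h
    · intro i j h hi
      by_contra hj
      obtain ⟨u, hu, hne⟩ := h₂ i j (by rintro rfl; exact hj hi)
      exact hne (h u hu)

theorem maximal_cl_eq_image (hk : 1 ≤ k) :
    {v | Maximal (fun u => u ∈ Cl (S12 k) S) v} =
      charVec '' {T | Maximal (Indep (coHypergraph k S)) T} := by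
  ext v
  constructor
  · intro h
    exact ⟨_, (maximal_cl hk).1 h, charVec_setOf v⟩
  · rintro ⟨T, hT, rfl⟩
    refine (maximal_cl hk).2 ?_
    simpa using hT

/-- The maximal vectors different from the constants, when the vector `1` is not in the closure. -/
theorem maximal_cl_diff (hk : 1 ≤ k) (h : ¬ Indep (coHypergraph k S) Set.univ)
    {v : Fin n → Bool} :
    Maximal (fun u => u ∈ Cl (S12 k) S \ {(fun _ => false), (fun _ => true)}) v ↔
      Maximal (Indep (coHypergraph k S)) {i | v i = true} ∧ ∃ i, v i = true := by
  have h1 : (fun _ => true) ∉ Cl (S12 k) S := fun h1 => h (by simpa using indep_of_mem_cl hk h1)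
  rw [← maximal_cl hk]
  have hne : ∀ v : Fin n → Bool, (∃ i, v i = true) ↔ v ≠ fun _ => false := by
    intro v
    rw [Function.ne_iff]
    simp
  rw [hne]
  constructor
  · intro hv
    refine ⟨⟨hv.prop.1, fun u hu hle => hv.le_of_ge ⟨hu, ?_⟩ hle⟩, fun h0 => hv.prop.2 (Or.inl h0)⟩
    rintro (rfl | rfl)
    · exact hv.prop.2 (Or.inl (le_antisymm hle fun i => by simp))
    · exact h1 hu
  · rintro ⟨hv, h0⟩
    refine ⟨⟨hv.prop, ?_⟩, fun u hu hle => hv.le_of_ge hu.1 hle⟩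
    rintro (rfl | rfl)
    · exact h0 rfl
    · exact h1 hv.prop

/-- The maximal vectors different from the constants, when the vector `1` is in the closure: the
complements of the classes of coordinates. -/
theorem maximal_cl_diff_of_indep (hk : 1 ≤ k) (h : Indep (coHypergraph k S) Set.univ)
    {v : Fin n → Bool} :
    Maximal (fun u => u ∈ Cl (S12 k) S \ {(fun _ => false), (fun _ => true)}) v ↔
      ∃ i, ¬ IsOne S i ∧ (∀ j < i, ¬ Twins S i j) ∧ (∃ j, ¬ Twins S i j) ∧
        v = charVec {j | ¬ Twins S i j} := by
  -- When every set is independent, compatibility alone decides membership in the closure.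
  have hmem : ∀ i, ¬ IsOne S i → charVec {j | ¬ Twins S i j} ∈ Cl (S12 k) S := by
    intro i hi
    refine cl_of_indep hk (nonempty_of_indep h) (h.mono (Set.subset_univ _)) ?_ ?_
    · intro j hj ht
      exact hi fun u hu => (ht u hu).trans (hj u hu)
    · intro j l hjl hj hl
      exact hj (hl.trans hjl.symm)
  have hone : ∀ i, charVec {j | ¬ Twins S i j} ≠ fun _ => true := by
    intro i h
    have : charVec {j | ¬ Twins S i j} i = true := by rw [h]
    rw [charVec_apply] at this
    exact this (.refl i)
  -- The complement of the class of `i` is the greatest vector of the closure that vanishes at `i`.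
  have hmax : ∀ i, ∀ u ∈ Cl (S12 k) S, u i = false → u ≤ charVec {j | ¬ Twins S i j} := by
    intro i u hu hi j hj
    refine charVec_apply.2 fun ht => ?_
    have hj' : u j = true := hj
    rw [← cl_twins ht hu, hi] at hj'
    simp at hj'
  constructor
  · intro hv
    have : ∃ i, v i = false := by
      by_contra! h'
      exact hv.prop.2 (Or.inr (funext fun i => by simpa using h' i))
    -- The least zero of `v` is the least member of its class; this canonical choice later ensures
    -- that each class is output once.
    let i := Fin.find (fun i => v i = false) this
    have hi : v i = false := Fin.find_spec this
    have hmin : ∀ j < i, ¬ v j = false := fun j hj => Fin.find_min this hj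
    have hle := hmax i v hv.prop.1 hi
    have hio : ¬ IsOne S i := fun ho => by
      have := cl_isOne ho hv.prop.1
      simp [hi] at this
    have h0 : charVec {j | ¬ Twins S i j} ≠ fun _ => false := by
      intro h0
      rw [h0] at hle
      exact hv.prop.2 (Or.inl (le_antisymm hle fun i => by simp))
    refine ⟨i, hio, fun j hj ht => hmin j hj ?_, ?_, ?_⟩
    · rw [← cl_twins ht hv.prop.1, hi]
    · by_contra! h'
      exact h0 (by ext j; simp [charVec, h'])
    · exact hv.eq_of_le ⟨hmem i hio, by rintro (h | h); exacts [h0 h, hone i h]⟩ hle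
  · rintro ⟨i, hi, -, ⟨j, hj⟩, rfl⟩
    refine ⟨⟨hmem i hi, ?_⟩, fun u hu hle => ?_⟩
    · rintro (h | h)
      · have := charVec_apply.2 (show j ∈ {j | ¬ Twins S i j} from hj)
        rw [h] at this
        simp at this
      · exact hone i h
    · have : ∃ l, u l = false := by
        by_contra! h'
        exact hu.2 (Or.inr (funext fun i => by simpa using h' i))
      obtain ⟨l, hl⟩ := this
      have hil : Twins S i l := by
        by_contra hil
        have h1 : u l = true := hle l (charVec_apply.2 hil)
        simp [hl] at h1
      exact hmax i u hu.1 (by rw [cl_twins hil hu.1, hl])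

end Closure

end EnumRed

namespace EnumRed

/-! ### Logic and arithmetic in the program language. -/

namespace Tm

/-- No output actions. -/
def isPure : Tm → Bool
  | var _ => true
  | const _ => true
  | bin _ x y => x.isPure && y.isPure
  | read x => x.isPure
  | sum _ x y => x.isPure && y.isPure
  | cond x y => x.isPure && y.isPure
  | write _ => false
  | emit => false

theorem ops_of_isPure {t : Tm} (h : t.isPure = true) (w : Word) (e : ℕ → ℕ) : t.ops w e = [] := by
  induction t generalizing e with
  | var | const => rfl
  | write | emit => simp [isPure] at h
  | bin o x y hx hy | sum v x y hx hy | cond x y hx hy =>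
    simp only [isPure, Bool.and_eq_true] at h
    simp [ops, hx h.1, hy h.2]
  | read x hx => exact hx h e

/-- The value is not `0`. -/
def Holds (w : Word) (t : Tm) (e : ℕ → ℕ) : Prop := t.eval w e ≠ 0

noncomputable instance (w : Word) (t : Tm) (e : ℕ → ℕ) : Decidable (t.Holds w e) :=
  Classical.dec _

def plus (x y : Tm) : Tm := bin .add x y
def minus (x y : Tm) : Tm := bin .sub x y
def times (x y : Tm) : Tm := bin .mul x y
-- An addition runs the output actions of both arguments in order; its value is ignored.
def seq (x y : Tm) : Tm := bin .add x y
-- Truth means being nonzero: conjunction is a product, disjunction and bounded existence are sums,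
-- and comparisons use that subtraction is truncated at `0`.
def not (x : Tm) : Tm := bin .sub (const 1) x
def and (x y : Tm) : Tm := bin .mul x y
def or (x y : Tm) : Tm := bin .add x y
def le (x y : Tm) : Tm := bin .sub (bin .add y (const 1)) x
def eq (x y : Tm) : Tm := bin .sub (const 1) (bin .add (bin .sub x y) (bin .sub y x))
def iff (x y : Tm) : Tm := or (and x y) (and x.not y.not)
def ex (v : ℕ) (x y : Tm) : Tm := sum v x y
def all (v : ℕ) (x y : Tm) : Tm := not (sum v x y.not)
/-- The letter at position `x` has code `c`. -/
def letter (c : ℕ) (x : Tm) : Tm := eq (read x) (const c)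

section

variable (w : Word) (e : ℕ → ℕ) (x y : Tm)

@[simp] theorem eval_var (v : ℕ) : (var v).eval w e = e v := rfl
@[simp] theorem eval_const (c : ℕ) : (const c).eval w e = c := rfl
@[simp] theorem eval_read : (read x).eval w e = inputAt w (x.eval w e) := rfl
@[simp] theorem eval_plus : (plus x y).eval w e = x.eval w e + y.eval w e := rfl
@[simp] theorem eval_minus : (minus x y).eval w e = x.eval w e - y.eval w e := rfl
@[simp] theorem eval_times : (times x y).eval w e = x.eval w e * y.eval w e := rfl
theorem eval_sum (v : ℕ) : (sum v x y).eval w e =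
  ∑ i ∈ Finset.range (x.eval w e), y.eval w (Function.update e v i) := rfl

theorem eval_eq : (eq x y).eval w e = if x.eval w e = y.eval w e then 1 else 0 := by
  simp only [eq, eval, BinOp.eval]
  split_ifs <;> omega

@[simp] theorem holds_not : (not x).Holds w e ↔ ¬ x.Holds w e := by
  simp only [Holds, not, eval, BinOp.eval]
  omega

theorem eval_not : (not x).eval w e = if x.Holds w e then 0 else 1 := by
  by_cases h : x.Holds w e
  · rw [if_pos h]
    simp only [Holds, not, eval, BinOp.eval] at h ⊢
    omega
  · rw [if_neg h]
    simp only [Holds, not, eval, BinOp.eval] at h ⊢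
    omega

@[simp] theorem holds_and : (and x y).Holds w e ↔ x.Holds w e ∧ y.Holds w e := by
  simp [Holds, and, eval, BinOp.eval]

@[simp] theorem holds_or : (or x y).Holds w e ↔ x.Holds w e ∨ y.Holds w e := by
  simp only [Holds, or, eval, BinOp.eval]
  omega

@[simp] theorem holds_le : (le x y).Holds w e ↔ x.eval w e ≤ y.eval w e := by
  simp only [Holds, le, eval, BinOp.eval]
  omega

@[simp] theorem holds_eq : (eq x y).Holds w e ↔ x.eval w e = y.eval w e := by
  simp [Holds, eval_eq]

@[simp] theorem holds_iff : (iff x y).Holds w e ↔ (x.Holds w e ↔ y.Holds w e) := by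
  simp only [iff, holds_or, holds_and, holds_not]
  tauto

@[simp] theorem holds_ex (v : ℕ) : (ex v x y).Holds w e ↔
    ∃ i < x.eval w e, y.Holds w (Function.update e v i) := by
  simp [Holds, ex, eval_sum]

@[simp] theorem holds_all (v : ℕ) : (all v x y).Holds w e ↔
    ∀ i < x.eval w e, y.Holds w (Function.update e v i) := by
  rw [all, holds_not]
  have := holds_ex w e x y.not v
  rw [ex] at this
  rw [this]
  simp

@[simp] theorem holds_letter (c : ℕ) : (letter c x).Holds w e ↔ inputAt w (x.eval w e) = c := by
  simp [letter]

@[simp] theorem holds_const (c : ℕ) : (const c).Holds w e ↔ c ≠ 0 := Iff.rfl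

theorem ops_sum (v : ℕ) : (sum v x y).ops w e = x.ops w e ++
  (List.range (x.eval w e)).flatMap fun i => y.ops w (Function.update e v i) := rfl

@[simp] theorem ops_seq : (seq x y).ops w e = x.ops w e ++ y.ops w e := rfl
@[simp] theorem ops_write (l : Letter) : (write l).ops w e = [some l] := rfl
@[simp] theorem ops_emit : emit.ops w e = [none] := rfl

theorem ops_cond (hx : x.isPure = true) :
    (cond x y).ops w e = if x.Holds w e then y.ops w e else [] := by
  simp only [ops, ops_of_isPure hx, Holds, List.nil_append]
  split_ifs <;> simp_all

end

/-- The length of the input. -/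
def len : Tm := var 0

/-- The number of positions before the first separator. -/
def dim : Tm := sum 1 len (not (ex 2 (plus (var 1) (const 1)) (letter 3 (var 2))))

end Tm

open Tm

/-- The number of positions of `w` before the first separator. -/
noncomputable def dimOf (w : Word) : ℕ := dim.eval w (env₀ w)

/-- `dim` binds every variable it uses except variable `0`, so it can be evaluated inside any loops
that leave that one alone. -/
theorem eval_dim {w : Word} {e : ℕ → ℕ} (he : e 0 = w.length) : dim.eval w e = dimOf w := by
  simp [dimOf, dim, eval_sum, eval_not, len, he, env₀]

theorem isPure_dim : dim.isPure = true := rfl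

/-! ### Words made of rows -/

/-- Vectors of size `n`, each followed by a separator. -/
def rows {n : ℕ} (L : List (Fin n → Bool)) : Word := L.flatMap fun v => vecWord v ++ [Letter.sep]

@[simp] theorem length_vecWord {n : ℕ} (v : Fin n → Bool) : (vecWord v).length = n := by
  simp [vecWord]

theorem vecWord_injective {n : ℕ} : Function.Injective (vecWord (n := n)) := by
  intro u v h
  have := List.ofFn_injective h
  ext i
  have hi := congrFun this i
  cases hu : u i <;> cases hv : v i <;> simp_all

theorem rows_cons {n : ℕ} (v : Fin n → Bool) (L : List (Fin n → Bool)) :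
    rows (v :: L) = vecWord v ++ [Letter.sep] ++ rows L := by simp [rows]

theorem length_rows {n : ℕ} (L : List (Fin n → Bool)) : (rows L).length = L.length * (n + 1) := by
  induction L with
  | nil => simp [rows]
  | cons v L ih => simp [rows_cons, ih]; ring

/-- The unary header is itself a row, consisting of ones. An instance is thus a uniform table of
rows of width `n + 1`, and vector number `r` is row number `r + 1`. -/
theorem familyWord_eq {n : ℕ} (L : List (Fin n → Bool)) :
    familyWord n L = rows ((fun _ => true) :: L) := by
  simp [familyWord, rows, vecWord, List.ofFn_const]

theorem getElem?_rows {n : ℕ} (L : List (Fin n → Bool)) (y : Word) {r j : ℕ} (hr : r < L.length)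
    (hj : j < n + 1) : (rows L ++ y)[r * (n + 1) + j]? =
      some (if h : j < n then if L[r] ⟨j, h⟩ then Letter.one else Letter.zero else Letter.sep) := by
  induction L generalizing r with
  | nil => simp at hr
  | cons v L ih =>
    rw [rows_cons]
    cases r with
    | zero =>
      simp only [zero_mul, zero_add, List.append_assoc]
      split_ifs with h h'
      · rw [List.getElem?_append_left (by simpa using h)]
        simp at h'
        simp [vecWord, h, h']
      · rw [List.getElem?_append_left (by simpa using h)]
        simp at h'
        simp [vecWord, h, h']
      · obtain rfl : j = n := by omega
        rw [List.getElem?_append_right (by simp)]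
        simp
    | succ r =>
      rw [List.append_assoc, List.getElem?_append_right (by simp; nlinarith)]
      have h1 : (r + 1) * (n + 1) + j - (vecWord v ++ [Letter.sep]).length =
          r * (n + 1) + j := by
        simp [Nat.add_mul]; omega
      rw [h1]
      exact ih (by simpa using hr)

theorem inputAt_rows {n : ℕ} (L : List (Fin n → Bool)) (y : Word) {r j : ℕ} (hr : r < L.length)
    (hj : j < n + 1) : inputAt (rows L ++ y) (r * (n + 1) + j) =
      if h : j < n then if L[r] ⟨j, h⟩ then 2 else 1 else 3 := by
  unfold inputAt
  rw [getElem?_rows L y hr hj]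
  simp only
  split_ifs <;> rfl

/-- A word with separators in the right places is made of rows. -/
theorem exists_rows {n m : ℕ} {w : Word} (hw : w.length = m * (n + 1))
    (hs : ∀ r < m, ∀ j < n + 1, inputAt w (r * (n + 1) + j) = 3 ↔ j = n) :
    ∃ L : List (Fin n → Bool), L.length = m ∧ w = rows L := by
  let L : List (Fin n → Bool) :=
    List.ofFn fun (r : Fin m) (j : Fin n) => decide (inputAt w (r * (n + 1) + j) = 2)
  have hL : L.length = m := by simp [L]
  refine ⟨L, hL, List.ext_getElem? fun p => ?_⟩
  by_cases hp : p < m * (n + 1)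
  · have hr : p / (n + 1) < m := Nat.div_lt_of_lt_mul (by rwa [mul_comm])
    have hj : p % (n + 1) < n + 1 := Nat.mod_lt _ (by omega)
    have hpe : p / (n + 1) * (n + 1) + p % (n + 1) = p := Nat.div_add_mod' p (n + 1)
    have h1 := getElem?_rows L [] (r := p / (n + 1)) (by rw [hL]; exact hr) hj
    have h2 := hs _ hr _ hj
    rw [hpe, List.append_nil] at h1
    rw [hpe] at h2
    rw [h1]
    have h3 : w[p]? = some w[p] := List.getElem?_eq_getElem (by omega)
    have h4 : inputAt w p = (w[p]'(by omega)).code := by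
      simp [inputAt, h3]
    rw [h3]
    congr 1
    have h5 : ∀ h : p % (n + 1) < n, L[p / (n+1)] ⟨p % (n+1), h⟩ =
        decide (inputAt w p = 2) := by
      intro h
      simp only [L, List.getElem_ofFn]
      rw [hpe]
    generalize w[p]'(by omega) = a at *
    by_cases h : p % (n + 1) < n
    · simp only [h, dif_pos, h5, h4]
      have h6 : a.code ≠ 3 := by rw [← h4, Ne, h2]; omega
      cases a <;> simp_all [Letter.code]
    · simp only [h, dif_neg, not_false_eq_true]
      have h6 : a.code = 3 := by rw [← h4, h2]; omega
      cases a <;> simp_all [Letter.code]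
  · rw [List.getElem?_eq_none (by omega), List.getElem?_eq_none]
    rw [length_rows, hL]
    omega

/-! ### Reading an instance from a word, possibly followed by a solution. -/

section Instances

variable {n : ℕ} {L : List (Fin n → Bool)} {y w : Word}

theorem length_familyWord : (familyWord n L).length = (L.length + 1) * (n + 1) := by
  rw [familyWord_eq, length_rows, List.length_cons]

theorem inputAt_header (hw : w = familyWord n L ++ y) {p : ℕ} (hp : p < n) : inputAt w p = 2 := by
  have := inputAt_rows ((fun _ => true) :: L) y (r := 0) (j := p) (by simp) (by omega)
  rw [hw, familyWord_eq]
  simpa [hp] using this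

theorem inputAt_header_end (hw : w = familyWord n L ++ y) : inputAt w n = 3 := by
  have := inputAt_rows ((fun _ => true) :: L) y (r := 0) (j := n) (by simp) (by omega)
  rw [hw, familyWord_eq]
  simpa using this

theorem dimOf_eq (hw : w = familyWord n L ++ y) : dimOf w = n := by
  have hn : n ≤ w.length := by
    rw [hw, List.length_append, length_familyWord]
    nlinarith
  have key : ∀ p, (∃ q < p + 1, inputAt w q = 3) ↔ ¬ p < n := by
    intro p
    constructor
    · rintro ⟨q, hq, h⟩ hp
      rw [inputAt_header hw (by omega)] at h
      omega
    · intro h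
      exact ⟨n, by omega, inputAt_header_end hw⟩
  simp only [dimOf, dim, eval_sum, len, eval_not, holds_ex, holds_letter, eval_plus, eval_var,
    eval_const, Function.update_self, env₀, if_true, key]
  have : ∀ p, (if ¬ p < n then 0 else 1) = if p < n then 1 else 0 := by
    intro p
    split_ifs <;> rfl
  simp only [this]
  rw [Finset.sum_ite, Finset.sum_const_zero, add_zero, Finset.sum_const, smul_eq_mul, mul_one]
  have : (Finset.range w.length).filter (fun p => p < n) = Finset.range n := by
    ext p
    simp only [Finset.mem_filter, Finset.mem_range]
    omega
  rw [this, Finset.card_range]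

/-- The first separator determines the size, the length then gives the number of vectors, and the
letters their entries. Hence an existential over encodings has only one witness. -/
theorem familyWord_inj {n' : ℕ} {L' : List (Fin n' → Bool)} (h : familyWord n L = familyWord n' L') :
    ∃ hn : n = n', hn ▸ L = L' := by
  have h1 : dimOf (familyWord n L) = n := dimOf_eq (L := L) (y := []) (by simp)
  have h2 : dimOf (familyWord n' L') = n' := dimOf_eq (L := L') (y := []) (by simp)
  obtain rfl : n = n' := by rw [← h1, ← h2, h]
  refine ⟨rfl, ?_⟩
  change L = L'
  have hl := congrArg List.length h
  rw [length_familyWord, length_familyWord] at hl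
  have hl := Nat.eq_of_mul_eq_mul_right (by omega) hl
  refine List.ext_getElem (by omega) fun r hr hr' => ?_
  ext j
  have e1 := inputAt_rows ((fun _ => true) :: L) [] (r := r + 1) (j := j) (by simpa using hr)
    (by omega)
  have e2 := inputAt_rows ((fun _ => true) :: L') [] (r := r + 1) (j := j) (by simpa using hr')
    (by omega)
  rw [← familyWord_eq, List.append_nil] at e1 e2
  rw [h, e2] at e1
  simp only [j.2, dif_pos, List.getElem_cons_succ, Fin.eta] at e1
  cases h3 : L[r] j <;> cases h4 : L'[r] j <;> simp_all

/-- The bit number `i` of the row number `r` is `1`. -/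
def Cell (w : Word) (r i : ℕ) : Prop := inputAt w ((r + 1) * (dimOf w + 1) + i) = 2

/-- `r` is the number of a row in an instance of length `X`. -/
def IsRow (w : Word) (X r : ℕ) : Prop := (r + 2) * (dimOf w + 1) ≤ X

theorem cell_iff (hw : w = familyWord n L ++ y) {r i : ℕ} (hr : r < L.length) (hi : i < n) :
    Cell w r i ↔ L[r] ⟨i, hi⟩ = true := by
  have := inputAt_rows ((fun _ => true) :: L) y (r := r + 1) (j := i) (by simpa using hr)
    (by omega)
  rw [Cell, dimOf_eq hw, hw, familyWord_eq, this]
  simp [hi]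

/-- The length of the instance is a separate argument of `IsRow`, so that the appended word `y` is
not taken for rows. -/
theorem isRow_iff (hw : w = familyWord n L ++ y) {r : ℕ} :
    IsRow w (familyWord n L).length r ↔ r < L.length := by
  rw [IsRow, dimOf_eq hw, length_familyWord]
  constructor
  · intro h
    have := Nat.le_of_mul_le_mul_right h (by omega)
    omega
  · intro h
    exact Nat.mul_le_mul_right _ (by omega)

theorem forall_rows (hw : w = familyWord n L ++ y) (P : (Fin n → Prop) → Prop) :
    (∀ r, IsRow w (familyWord n L).length r → P fun i => Cell w r i) ↔
      ∀ u ∈ L, P fun i => u i = true := by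
  rw [List.forall_mem_iff_getElem]
  refine forall_congr' fun r => ?_
  rw [isRow_iff hw]
  refine forall_congr' fun hr => ?_
  have : (fun i : Fin n => Cell w r i) = fun i => L[r] i = true := by
    ext i
    exact cell_iff hw hr i.2
  rw [this]

end Instances

/-! ### Recognizing the words that encode instances. -/

namespace Tm

/-- Test for being the word of a family of vectors. -/
def valid : Tm :=
  and (all 3 dim (letter 2 (var 3)))
    (and (ex 3 len (eq len (times (plus (var 3) (const 1)) (plus dim (const 1)))))
      (all 3 len (iff (letter 3 (var 3)) (ex 4 len
        (eq (times (plus (var 4) (const 1)) (plus dim (const 1))) (plus (var 3) (const 1)))))))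

/-- Three conditions suffice: the letters before the first separator are ones, the length is a
positive multiple of the width, and separators stand exactly at the ends of rows. All other letters
are then bits. -/
theorem holds_valid {w : Word} {e : ℕ → ℕ} (he : e 0 = w.length) :
    valid.Holds w e ↔ ∃ (n : ℕ) (L : List (Fin n → Bool)), w = familyWord n L := by
  have h3 : ∀ i, Function.update e 3 i 0 = w.length := by simp [he]
  have h4 : ∀ i j, Function.update (Function.update e 3 i) 4 j 0 = w.length := by simp [he]
  simp only [valid, holds_and, holds_all, holds_ex, holds_letter, holds_iff, holds_eq, eval_times,
    eval_plus, eval_var, eval_const, eval_dim he, eval_dim (h3 _), eval_dim (h4 _ _), len, he,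
    Function.update_self]
  simp only [Function.update_apply, he]
  norm_num
  constructor
  · rintro ⟨h1, ⟨m, hm, h2⟩, h3⟩
    obtain ⟨L, hL, hw⟩ := exists_rows h2 (fun r hr j hj => by
      have hlt : r * (dimOf w + 1) + j < w.length := by
        rw [h2]
        calc r * (dimOf w + 1) + j < (r + 1) * (dimOf w + 1) := by nlinarith
          _ ≤ (m + 1) * (dimOf w + 1) := Nat.mul_le_mul_right _ (by omega)
      rw [h3 _ hlt]
      constructor
      · rintro ⟨q, hq, h⟩
        have h5 : (r * (dimOf w + 1) + j + 1) % (dimOf w + 1) = 0 := by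
          rw [← h, Nat.mul_mod_left]
        rw [show r * (dimOf w + 1) + j + 1 = j + 1 + r * (dimOf w + 1) by ring,
          Nat.add_mul_mod_self_right] at h5
        have h6 := Nat.le_of_dvd (by omega) (Nat.dvd_of_mod_eq_zero h5)
        omega
      · rintro rfl
        refine ⟨r, ?_, by ring⟩
        have : r ≤ r * (dimOf w + 1) := Nat.le_mul_of_pos_right _ (by omega)
        omega)
    obtain ⟨v, L', rfl⟩ : ∃ v L', L = v :: L' := by
      cases L with
      | nil => simp at hL
      | cons v L' => exact ⟨v, L', rfl⟩
    refine ⟨dimOf w, L', ?_⟩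
    have hv : v = fun _ => true := by
      ext i
      have h4 := inputAt_rows (v :: L') [] (r := 0) (j := i) (by simp) (by omega)
      rw [List.append_nil, ← hw] at h4
      have h5 := h1 i i.2
      simp only [zero_mul, zero_add] at h4
      rw [h4] at h5
      simpa using h5
    rw [familyWord_eq, ← hv]
    exact hw
  · rintro ⟨n, L, hw⟩
    have hw' : w = familyWord n L ++ [] := by simpa using hw
    have hd := dimOf_eq hw'
    have hlen : w.length = (L.length + 1) * (n + 1) := by rw [hw, length_familyWord]
    rw [hd]
    refine ⟨fun p hp => inputAt_header hw' hp, ⟨L.length, by rw [hlen]; nlinarith, hlen⟩, ?_⟩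
    intro p hp
    have hr : p / (n + 1) < L.length + 1 :=
      Nat.div_lt_of_lt_mul (by rw [mul_comm, ← hlen]; exact hp)
    have hj : p % (n + 1) < n + 1 := Nat.mod_lt _ (by omega)
    have hpe : p / (n + 1) * (n + 1) + p % (n + 1) = p := Nat.div_add_mod' p (n + 1)
    have h1 := inputAt_rows ((fun _ => true) :: L) [] (r := p / (n + 1)) (by simpa using hr) hj
    rw [← familyWord_eq, ← hw', hpe] at h1
    have h2 : inputAt w p = 3 ↔ p % (n + 1) = n := by
      rw [h1]
      split_ifs <;> simp <;> omega
    rw [h2]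
    constructor
    · intro h
      refine ⟨p / (n + 1), ?_, ?_⟩
      · exact (Nat.div_le_self _ _).trans_lt hp
      · rw [add_mul, ← hpe]
        simp only [h]
        have := hpe
        rw [h] at this
        rw [this]
        omega
    · rintro ⟨q, hq, h⟩
      have : p = n + q * (n + 1) := by
        rw [add_mul] at h
        omega
      rw [this, Nat.add_mul_mod_self_right, Nat.mod_eq_of_lt (by omega)]

theorem isPure_valid : valid.isPure = true := rfl

end Tm

end EnumRed

namespace EnumRed

/-! ### Programs for rows, vectors and sets of at most `k` coordinates. -/

theorem writes_append (y z : Word) : writes (y ++ z) = writes y ++ writes z := List.map_append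

theorem writes_flatMap {α : Type*} (l : List α) (f : α → Word) :
    writes (l.flatMap f) = l.flatMap fun a => writes (f a) := List.map_flatMap

theorem flatMap_ite {α β : Type*} (l : List α) (p : α → Prop) [DecidablePred p] (f : α → List β) :
    (l.flatMap fun a => if p a then f a else []) = (l.filter p).flatMap f := by
  induction l with
  | nil => rfl
  | cons a l ih =>
    by_cases h : p a <;> simp [h, ih]

namespace Tm

/-- Quantification over the rows of an instance of length `X`; the row number is variable `3`. -/
def allRows (X x : Tm) : Tm :=
  all 3 len (or (not (le (times (plus (var 3) (const 2)) (plus dim (const 1))) X)) x)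

def cell (x : Tm) : Tm :=
  letter 2 (plus (times (plus (var 3) (const 1)) (plus dim (const 1))) x)

/-- Write the vector whose coordinates are the truth values of `x`, for the variable `5`. -/
def writeVec (x : Tm) : Tm :=
  sum 5 dim (seq (cond x (write .one)) (cond (not x) (write .zero)))

/-- The value of `x` is among the values of the variables `10`, ..., `10 + k - 1`. -/
def mem (x : Tm) : ℕ → Tm
  | 0 => const 0
  | k + 1 => or (mem x k) (eq (var (10 + k)) x)

/-- Run `x` for all values in `{0, ..., dim}` of the variables `10`, ..., `10 + k - 1`. -/
def forTuples (x : Tm) : ℕ → Tm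
  | 0 => x
  | k + 1 => sum (10 + k) (plus dim (const 1)) (forTuples x k)

variable {w : Word} {e : ℕ → ℕ}

theorem eval_len (he : e 0 = w.length) : len.eval w e = w.length := he

/-- Row numbers are smaller than the length of the word, so `len` is a sufficient range for the
quantifier. -/
theorem holds_allRows {X x : Tm} {m : ℕ} (he : e 0 = w.length) (hm : m ≤ w.length)
    (hX : ∀ e : ℕ → ℕ, e 0 = w.length → X.eval w e = m) :
    (allRows X x).Holds w e ↔ ∀ r, IsRow w m r → x.Holds w (Function.update e 3 r) := by
  have h : ∀ r, Function.update e 3 r 0 = w.length := by simp [he]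
  simp only [allRows, holds_all, holds_or, holds_not, holds_le, eval_times, eval_plus, eval_var,
    eval_const, Function.update_self, hX _ (h _), eval_dim (h _), len, he, IsRow]
  constructor
  · intro h1 r hr
    refine (h1 r ?_).resolve_left (not_not.2 hr)
    nlinarith
  · intro h1 r _
    exact Classical.or_iff_not_imp_left.2 fun h2 => h1 r (not_not.1 h2)

theorem holds_cell {x : Tm} (he : e 0 = w.length) :
    (cell x).Holds w e ↔ Cell w (e 3) (x.eval w e) := by
  simp [cell, Cell, eval_dim he]

/-- The exact value `0` or `1` matters in `smallRows`, where summing cells counts ones. -/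
theorem eval_cell {x : Tm} (he : e 0 = w.length) [Decidable (Cell w (e 3) (x.eval w e))] :
    (cell x).eval w e = if Cell w (e 3) (x.eval w e) then 1 else 0 := by
  simp only [cell, Cell, letter, eval_eq, eval_read, eval_plus, eval_times, eval_var, eval_const,
    eval_dim he]
  congr

theorem holds_mem {x : Tm} {k : ℕ} :
    (mem x k).Holds w e ↔ ∃ j < k, e (10 + j) = x.eval w e := by
  induction k with
  | zero => simp [mem]
  | succ k ih =>
    simp only [mem, holds_or, ih, holds_eq, eval_var, Nat.lt_succ_iff_lt_or_eq, or_and_right,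
      exists_or, exists_eq_left]

theorem isPure_mem {x : Tm} (hx : x.isPure = true) (k : ℕ) : (mem x k).isPure = true := by
  induction k with
  | zero => rfl
  | succ k ih => simp [mem, or, eq, isPure, ih, hx]

theorem ops_writeVec {x : Tm} (he : e 0 = w.length) (hx : x.isPure = true) :
    (writeVec x).ops w e =
      writes (vecWord (charVec {i : Fin (dimOf w) | x.Holds w (Function.update e 5 i)})) := by
  have hx' : x.not.isPure = true := by simp [not, isPure, hx]
  simp only [writeVec, ops_sum, ops_of_isPure isPure_dim, eval_dim he, ops_seq, ops_cond _ _ _ _ hx,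
    ops_cond _ _ _ _ hx', ops_write, holds_not, List.nil_append, vecWord, writes]
  rw [List.ofFn_eq_map, List.map_map, ← List.map_coe_finRange_eq_range, List.flatMap_map,
    List.map_eq_flatMap]
  refine List.flatMap_congr fun i _ => ?_
  by_cases h : x.Holds w (Function.update e 5 i) <;> simp [charVec, h]

end Tm

/-- The values of the variables in the rounds of `Tm.forTuples`. -/
def tuples (n : ℕ) : ℕ → (ℕ → ℕ) → List (ℕ → ℕ)
  | 0, e => [e]
  | k + 1, e => (List.range (n + 1)).flatMap fun i => tuples n k (Function.update e (10 + k) i)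

theorem apply_zero_of_mem_tuples {n k : ℕ} {e e' : ℕ → ℕ} (h : e' ∈ tuples n k e) :
    e' 0 = e 0 := by
  induction k generalizing e with
  | zero => simp_all [tuples]
  | succ k ih =>
    simp only [tuples, List.mem_flatMap] at h
    obtain ⟨i, -, h⟩ := h
    rw [ih h, Function.update_of_ne (by omega)]

theorem mem_tuples {n k : ℕ} {e e' : ℕ → ℕ} (h : ∀ i < k, e' (10 + i) ≤ n)
    (h' : ∀ u, (u < 10 ∨ 10 + k ≤ u) → e' u = e u) : e' ∈ tuples n k e := by
  induction k generalizing e with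
  | zero =>
    simp only [tuples, List.mem_singleton]
    exact funext fun u => h' u (by omega)
  | succ k ih =>
    simp only [tuples, List.mem_flatMap, List.mem_range]
    refine ⟨e' (10 + k), Nat.lt_succ_of_le (h k (by omega)), ih (fun i hi => h i (by omega)) ?_⟩
    intro u hu
    rw [Function.update_apply]
    split_ifs with huk
    · rw [huk]
    · exact h' u (by omega)

/-- The set of the values of the variables `10`, ..., `10 + k - 1`. -/
def tupleSet (k n : ℕ) (e : ℕ → ℕ) : Set (Fin n) := {i | ∃ j < k, e (10 + j) = i}

theorem ncard_tupleSet_le (k n : ℕ) (e : ℕ → ℕ) : (tupleSet k n e).ncard ≤ k := by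
  have h : Fin.val '' tupleSet k n e ⊆ ↑((Finset.range k).image fun j => e (10 + j)) := by
    rintro _ ⟨i, ⟨j, hj, he⟩, rfl⟩
    simpa using ⟨j, hj, he⟩
  have h1 := Set.ncard_le_ncard h (Finset.finite_toSet _)
  rw [Set.ncard_image_of_injective _ Fin.val_injective, Set.ncard_coe_finset] at h1
  exact h1.trans (Finset.card_image_le.trans (by simp))

/-- Sets with fewer than `k` elements are padded with the value `n`, which is no coordinate; this is
why tuples range up to `n` inclusive. -/
theorem exists_tupleSet {k n : ℕ} (e : ℕ → ℕ) {I : Set (Fin n)} (hI : I.ncard ≤ k) :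
    ∃ e' ∈ tuples n k e, tupleSet k n e' = I := by
  classical
  have hc : I.toFinite.toFinset.card ≤ k := by rwa [← Set.ncard_eq_toFinset_card]
  let l := I.toFinite.toFinset.toList
  have hl : l.length ≤ k := by simpa [l] using hc
  let g : ℕ → ℕ := fun j => if h : j < l.length then l[j] else n
  refine ⟨fun u => if 10 ≤ u ∧ u < 10 + k then g (u - 10) else e u, mem_tuples ?_ ?_, ?_⟩
  · intro i hi
    simp only [Nat.le_add_right, Nat.add_lt_add_iff_left, hi, and_self, if_true,
      Nat.add_sub_cancel_left, g]
    split_ifs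
    · exact (l[i]).2.le
    · exact le_rfl
  · intro u hu
    rw [if_neg (by omega)]
  · ext i
    have h1 : ∀ j < k, (if 10 ≤ 10 + j ∧ 10 + j < 10 + k then g (10 + j - 10) else e (10 + j)) =
        g j := by
      intro j hj
      rw [if_pos (by omega), Nat.add_sub_cancel_left]
    simp only [tupleSet, Set.mem_ofPred_eq]
    constructor
    · rintro ⟨j, hj, h⟩
      rw [h1 j hj] at h
      simp only [g] at h
      split_ifs at h with hjl
      · have : l[j] ∈ l := List.getElem_mem hjl
        rw [Fin.ext h] at this
        simpa [l] using this
      · have := i.2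
        omega
    · intro hi
      have : i ∈ l := by simpa [l] using hi
      obtain ⟨j, hj, h⟩ := List.getElem_of_mem this
      refine ⟨j, by omega, ?_⟩
      rw [h1 j (by omega)]
      simp only [g, hj, dif_pos, h]

namespace Tm

variable {w : Word} {e : ℕ → ℕ}

theorem ops_forTuples {x : Tm} {k : ℕ} (he : e 0 = w.length) :
    (forTuples x k).ops w e = (tuples (dimOf w) k e).flatMap fun e' => x.ops w e' := by
  induction k generalizing e with
  | zero => simp [forTuples, tuples]
  | succ k ih =>
    have h : ∀ i, Function.update e (10 + k) i 0 = w.length := fun i => by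
      rw [Function.update_of_ne (by omega), he]
    have hp : (plus dim (const 1)).isPure = true := rfl
    simp only [forTuples, ops_sum, tuples, ops_of_isPure hp, eval_plus, eval_dim he, eval_const,
      List.nil_append, ih (h _), List.flatMap_assoc]

/-- Writes the family of the sets of at most `k` elements with the property `c`. -/
def family (h b : Tm) (k : ℕ) (c : Tm) : Tm :=
  seq (seq h (seq (writeVec (const 1)) (write .sep)))
    (forTuples (cond c (seq b (seq (writeVec (mem (var 5) k)) (write .sep)))) k)

/-- The terms `h` and `b` write prefixes of the header and of each vector; the reduction from
hypergraphs uses them for its two extra coordinates. -/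
theorem ops_family {h b c : Tm} {k : ℕ} {hw bw : Word} (he : e 0 = w.length)
    (hh : ∀ e, h.ops w e = writes hw) (hb : ∀ e, b.ops w e = writes bw) (hc : c.isPure = true) :
    (family h b k c).ops w e = writes (hw ++ (vecWord (fun _ : Fin (dimOf w) => true) ++ [.sep]) ++
      ((tuples (dimOf w) k e).filter fun e' => c.Holds w e').flatMap fun e' =>
        bw ++ (vecWord (charVec (tupleSet k (dimOf w) e')) ++ [.sep])) := by
  have h5 : (var 5).isPure = true := rfl
  have h1 : (const 1).isPure = true := rfl
  simp only [family, ops_seq, hh, ops_writeVec he h1, ops_write, ops_forTuples he,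
    ops_cond _ _ _ _ hc, hb, writes_append, flatMap_ite]
  congr 1
  · simp [writes]
  · rw [writes_flatMap]
    refine List.flatMap_congr fun e' he' => ?_
    have h0 : e' 0 = w.length := by
      rw [apply_zero_of_mem_tuples (List.mem_filter.1 he').1, he]
    rw [ops_writeVec h0 (isPure_mem h5 k)]
    have : {i : Fin (dimOf w) | (mem (var 5) k).Holds w (Function.update e' 5 i)} =
        tupleSet k (dimOf w) e' := by
      ext i
      simp only [Set.mem_ofPred_eq, holds_mem, eval_var, Function.update_self, tupleSet]
      refine exists_congr fun j => and_congr_right fun _ => ?_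
      rw [Function.update_of_ne (by omega)]
    rw [this]
    simp [writes]

/-- No row contains the set of the values of the variables `10`, ..., `10 + k - 1`. -/
def uncovered (k : ℕ) : Tm :=
  allRows len (not (all 4 dim (or (not (mem (var 4) k)) (cell (var 4)))))

/-- No row is contained in the set of the values of the variables `10`, ..., `10 + k - 1`. -/
def rowFree (k : ℕ) : Tm :=
  allRows len (not (all 4 dim (or (not (cell (var 4))) (mem (var 4) k))))

/-- No row has more than `k` ones. -/
def smallRows (k : ℕ) : Tm := allRows len (le (sum 4 dim (cell (var 4))) (const k))

theorem isPure_uncovered (k : ℕ) : (uncovered k).isPure = true := by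
  have h : (var 4).isPure = true := rfl
  have h2 : (cell (var 4)).isPure = true := rfl
  simp [uncovered, allRows, isPure, all, or, not, le, times, plus, len, isPure_dim,
    isPure_mem h, h2]

theorem isPure_rowFree (k : ℕ) : (rowFree k).isPure = true := by
  have h : (var 4).isPure = true := rfl
  have h2 : (cell (var 4)).isPure = true := rfl
  simp [rowFree, allRows, isPure, all, or, not, le, times, plus, len, isPure_dim,
    isPure_mem h, h2]

variable {n k : ℕ} {L : List (Fin n → Bool)}

theorem holds_uncovered (hw : w = familyWord n L) (he : e 0 = w.length) :
    (uncovered k).Holds w e ↔ ∀ u ∈ L, ¬ ∀ i ∈ tupleSet k n e, u i = true := by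
  have hw' : w = familyWord n L ++ [] := by simpa using hw
  have h3 : ∀ r, Function.update e 3 r 0 = w.length := by simp [he]
  have h4 : ∀ r i, Function.update (Function.update e 3 r) 4 i 0 = w.length := by simp [he]
  rw [uncovered, holds_allRows he le_rfl fun _ => eval_len]
  have key := forall_rows hw' fun f => ¬ ∀ i ∈ tupleSet k n e, f i
  rw [← hw] at key
  rw [← key]
  refine forall_congr' fun r => imp_congr_right fun _ => ?_
  simp only [holds_not, holds_all, eval_dim (h3 _), holds_or, holds_mem, holds_cell (h4 _ _),
    eval_var, Function.update_self, dimOf_eq hw']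
  refine not_congr ⟨fun h i hi => ?_, fun h i hi => ?_⟩
  · have h1 := (h i i.2).resolve_left ?_
    · simpa [Function.update_apply] using h1
    · obtain ⟨j, hj, h2⟩ := hi
      refine not_not.2 ⟨j, hj, ?_⟩
      rw [Function.update_of_ne (by omega), Function.update_of_ne (by omega), h2]
  · refine Classical.or_iff_not_imp_left.2 fun h1 => ?_
    obtain ⟨j, hj, h2⟩ := not_not.1 h1
    rw [Function.update_of_ne (by omega), Function.update_of_ne (by omega)] at h2
    have := h ⟨i, hi⟩ ⟨j, hj, h2⟩
    simpa [Function.update_apply] using this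

theorem holds_rowFree (hw : w = familyWord n L) (he : e 0 = w.length) :
    (rowFree k).Holds w e ↔ ∀ u ∈ L, ¬ ∀ i, u i = true → i ∈ tupleSet k n e := by
  have hw' : w = familyWord n L ++ [] := by simpa using hw
  have h3 : ∀ r, Function.update e 3 r 0 = w.length := by simp [he]
  have h4 : ∀ r i, Function.update (Function.update e 3 r) 4 i 0 = w.length := by simp [he]
  rw [rowFree, holds_allRows he le_rfl fun _ => eval_len]
  have key := forall_rows hw' fun f => ¬ ∀ i, f i → i ∈ tupleSet k n e
  rw [← hw] at key
  rw [← key]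
  refine forall_congr' fun r => imp_congr_right fun _ => ?_
  simp only [holds_not, holds_all, eval_dim (h3 _), holds_or, holds_mem, holds_cell (h4 _ _),
    eval_var, Function.update_self, dimOf_eq hw']
  refine not_congr ⟨fun h i hi => ?_, fun h i hi => ?_⟩
  · obtain ⟨j, hj, h2⟩ := (h i i.2).resolve_left (by simpa [Function.update_apply] using hi)
    rw [Function.update_of_ne (by omega), Function.update_of_ne (by omega)] at h2
    exact ⟨j, hj, h2⟩
  · refine Classical.or_iff_not_imp_left.2 fun h1 => ?_
    obtain ⟨j, hj, h2⟩ := h ⟨i, hi⟩ (by simpa [Function.update_apply] using h1)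
    refine ⟨j, hj, ?_⟩
    rw [Function.update_of_ne (by omega), Function.update_of_ne (by omega), h2]

theorem holds_smallRows (hw : w = familyWord n L) (he : e 0 = w.length) :
    (smallRows k).Holds w e ↔ ∀ u ∈ L, {i | u i = true}.ncard ≤ k := by
  classical
  have hw' : w = familyWord n L ++ [] := by simpa using hw
  have h3 : ∀ r, Function.update e 3 r 0 = w.length := by simp [he]
  have h4 : ∀ r i, Function.update (Function.update e 3 r) 4 i 0 = w.length := by simp [he]
  rw [smallRows, holds_allRows he le_rfl fun _ => eval_len]
  have key := forall_rows hw' fun f => {i | f i}.ncard ≤ k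
  rw [← hw] at key
  rw [← key]
  refine forall_congr' fun r => imp_congr_right fun _ => ?_
  simp only [holds_le, eval_sum, eval_dim (h3 _), dimOf_eq hw', eval_cell (h4 _ _), eval_var,
    Function.update_self, eval_const]
  rw [Finset.sum_range, Finset.sum_boole, Set.ncard_eq_toFinset_card']
  simp

end Tm

end EnumRed

namespace EnumRed

open Tm

variable {k n : ℕ}

theorem env₀_zero (w : Word) : env₀ w 0 = w.length := rfl

theorem familyWord_ne_nil (L : List (Fin n → Bool)) : familyWord n L ≠ [] := by
  simp [familyWord]

theorem charVec_setOf_list (L : List (Fin n → Bool)) :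
    (L.map fun v => {i | v i = true}).map charVec = L := by
  simp [Function.comp_def]

/-! ### Solutions of the two problems -/

theorem enumClosureMax_familyWord (F : Set (Operation Bool)) (L : List (Fin n → Bool)) :
    EnumClosureMax F (familyWord n L) = {y | ∃ v : Fin n → Bool,
      Maximal (fun u => u ∈ Cl F {v | v ∈ L} \ {(fun _ => false), (fun _ => true)}) v ∧
      y = vecWord v} := by
  ext y
  constructor
  · rintro ⟨n', S, v, ⟨L', rfl, hw⟩, hv, rfl⟩
    obtain ⟨rfl, rfl⟩ := familyWord_inj hw
    exact ⟨v, hv, rfl⟩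
  · rintro ⟨v, hv, rfl⟩
    exact ⟨n, _, v, ⟨L, rfl, rfl⟩, hv, rfl⟩

theorem enumClosureMax_eq_empty {F : Set (Operation Bool)} {w : Word}
    (h : ¬ ∃ (n : ℕ) (L : List (Fin n → Bool)), w = familyWord n L) : EnumClosureMax F w = ∅ := by
  refine Set.eq_empty_of_forall_notMem ?_
  rintro y ⟨n, S, v, ⟨L, -, hw⟩, -⟩
  exact h ⟨n, L, hw⟩

theorem enumKMaxIndSet_eq {w : Word} {H : Hypergraph (Fin n)} (hH : EncodesHypergraph w H) :
    EnumKMaxIndSet k w = {y | dimension H ≤ k ∧ ∃ T, Maximal (Indep H) T ∧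
      y = vecWord (charVec T)} := by
  obtain ⟨hv, L, hL, hw⟩ := hH
  ext y
  constructor
  · rintro ⟨n', H', T, ⟨hv', L', hL', hw'⟩, hd, hT, rfl⟩
    obtain ⟨rfl, h⟩ := familyWord_inj (hw.symm.trans hw')
    have h : L = L' := (List.map_injective_iff.2 charVec_injective) h
    obtain rfl : H = H' := Hypergraph.ext (hv.trans hv'.symm) (by rw [hL, hL', h])
    exact ⟨hd, T, hT, rfl⟩
  · rintro ⟨hd, T, hT, rfl⟩
    exact ⟨n, H, T, ⟨hv, L, hL, hw⟩, hd, hT, rfl⟩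

theorem enumKMaxIndSet_eq_empty {w : Word}
    (h : ¬ ∃ (n : ℕ) (L : List (Fin n → Bool)), w = familyWord n L) : EnumKMaxIndSet k w = ∅ := by
  refine Set.eq_empty_of_forall_notMem ?_
  rintro y ⟨n, H, T, ⟨-, L, -, hw⟩, -⟩
  exact h ⟨n, _, hw⟩

/-- Both reductions send inputs without meaning to the empty word, which has no solutions. -/
theorem nil_not_familyWord : ¬ ∃ (n : ℕ) (L : List (Fin n → Bool)), [] = familyWord n L := by
  rintro ⟨n, L, h⟩
  exact familyWord_ne_nil L h.symm

/-- The hypergraph with the given hyperedges. -/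
def hypergraphOf (L : List (Fin n → Bool)) : Hypergraph (Fin n) where
  vertexSet := Set.univ
  edgeSet := {e | charVec e ∈ L}
  subset_vertexSet_of_mem_edgeSet' := fun _ _ => Set.subset_univ _

theorem encodes_hypergraphOf (L : List (Fin n → Bool)) :
    EncodesHypergraph (familyWord n L) (hypergraphOf L) := by
  refine ⟨rfl, L.map fun v => {i | v i = true}, ?_, by rw [charVec_setOf_list]⟩
  ext e
  simp only [hypergraphOf, Set.mem_ofPred_eq, List.mem_map]
  constructor
  · intro h
    exact ⟨_, h, by simp⟩
  · rintro ⟨v, hv, rfl⟩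
    simpa using hv

theorem dimension_le {H : Hypergraph (Fin n)} :
    dimension H ≤ k ↔ ∀ e ∈ H.edgeSet, e.ncard ≤ k := by
  simp only [dimension, iSup_le_iff]
  refine forall₂_congr fun e _ => ?_
  rw [← e.toFinite.cast_ncard_eq, Nat.cast_le]

theorem vecWord_cons (a : Bool) (v : Fin n → Bool) :
    vecWord (Fin.cons a v : Fin (n + 1) → Bool) =
      (if a then Letter.one else Letter.zero) :: vecWord v := by
  simp [vecWord, List.ofFn_succ]

theorem inputAt_append_vecWord {w x : Word} {v : Fin n → Bool} (hw : w = x ++ vecWord v)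
    (i : Fin n) : inputAt w (x.length + i) = 2 ↔ v i = true := by
  have : w[x.length + i]? = some (if v i then Letter.one else Letter.zero) := by
    rw [hw, List.getElem?_append_right (by omega)]
    simp [vecWord]
  rw [inputAt, this]
  cases v i <;> simp [Letter.code]

/-! ### From closures to independent sets -/

/-- The hyperedges of the hypergraph of a family of vectors. -/
noncomputable def coEdges (k n : ℕ) (w : Word) : List (Set (Fin n)) :=
  ((tuples n k (env₀ w)).filter fun e => (uncovered k).Holds w e).map (tupleSet k n)

/-- The map from families of vectors to hypergraphs. -/
noncomputable def toHypergraph (k : ℕ) (w : Word) : Word :=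
  if valid.Holds w (env₀ w) then familyWord (dimOf w) ((coEdges k (dimOf w) w).map charVec) else []

theorem polyTime_toHypergraph (k : ℕ) : PolyTime (toHypergraph k) := by
  refine Tm.polyTime (seq (cond valid (family (const 0) (const 0) k (uncovered k))) emit) _ ?_
  intro w
  rw [ops_seq, ops_cond _ _ _ _ isPure_valid, ops_family (hw := []) (bw := []) (env₀_zero w)
    (fun _ => rfl) (fun _ => rfl) (isPure_uncovered k), toHypergraph]
  simp only [ops_emit, outputs, List.flatMap_cons, List.flatMap_nil, List.append_nil]
  split_ifs
  · rw [familyWord_eq, rows, coEdges]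
    simp only [List.flatMap_cons, List.flatMap_map, List.nil_append]
  · rfl

theorem toHypergraph_familyWord (k : ℕ) (L : List (Fin n → Bool)) :
    EncodesHypergraph (toHypergraph k (familyWord n L)) (coHypergraph k {v | v ∈ L}) := by
  have hv : valid.Holds (familyWord n L) (env₀ (familyWord n L)) :=
    (holds_valid rfl).2 ⟨n, L, rfl⟩
  have hd : dimOf (familyWord n L) = n := dimOf_eq (L := L) (y := []) (by simp)
  rw [toHypergraph, if_pos hv, hd]
  refine ⟨rfl, _, ?_, rfl⟩
  ext I
  simp only [coHypergraph, coEdges, Set.mem_ofPred_eq, List.mem_map, List.mem_filter,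
    decide_eq_true_eq]
  constructor
  · rintro ⟨hc, h⟩
    obtain ⟨e, he, rfl⟩ := exists_tupleSet (env₀ (familyWord n L)) hc
    exact ⟨e, ⟨he, (holds_uncovered rfl (apply_zero_of_mem_tuples he)).2 h⟩, rfl⟩
  · rintro ⟨e, ⟨he, h⟩, rfl⟩
    exact ⟨ncard_tupleSet_le _ _ _, (holds_uncovered rfl (apply_zero_of_mem_tuples he)).1 h⟩

/-- The last `dimOf w` letters of `w`. -/
def LastBit (w : Word) (i : ℕ) : Prop := inputAt w (w.length - dimOf w + i) = 2

/-- The coordinates agree in all rows, apart from the last vector. -/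
def SameCol (w : Word) (i j : ℕ) : Prop :=
  ∀ r, IsRow w (w.length - dimOf w) r → (Cell w r i ↔ Cell w r j)

def OneCol (w : Word) (i : ℕ) : Prop := ∀ r, IsRow w (w.length - dimOf w) r → Cell w r i

/-- The last vector is the vector `1`. -/
def LastOne (w : Word) : Prop := ∀ i < dimOf w, LastBit w i

/-- The index `i` numbers the outputs. If the last vector is not `1`, it is output once, under index
`0`, unless it is zero. If it is `1`, the indices are the least members of the non-constant classes;
the final clause excludes the case of a single class, whose complement is the zero vector. -/
def Chosen (w : Word) (i : ℕ) : Prop :=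
  (¬ LastOne w ∧ i = 0 ∧ ∃ j < dimOf w, LastBit w j) ∨
    (LastOne w ∧ ¬ OneCol w i ∧ (∀ j < i, ¬ SameCol w i j) ∧ ∃ j < dimOf w, ¬ SameCol w i j)

def SolutionBit (w : Word) (i j : ℕ) : Prop :=
  (¬ LastOne w ∧ LastBit w j) ∨ (LastOne w ∧ ¬ SameCol w i j)

open Classical in
/-- The vectors obtained from a family of vectors and a maximal independent set. -/
noncomputable def closureSolutions (w : Word) : List Word :=
  ((List.range (dimOf w)).filter (Chosen w)).map fun i =>
    vecWord (charVec {j : Fin (dimOf w) | SolutionBit w i j})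

theorem sameCol_refl (w : Word) (i : ℕ) : SameCol w i i := fun _ _ => Iff.rfl

/-- The complement of the class of `i` misses `i`, so equal outputs come from twin indices, and both
of these are least in their class. -/
theorem nodup_closureSolutions (w : Word) : (closureSolutions w).Nodup := by
  classical
  refine List.Nodup.map_on ?_ (List.nodup_range.filter _)
  intro i hi j hj h
  simp only [List.mem_filter, List.mem_range, decide_eq_true_eq] at hi hj
  have h := Set.ext_iff.1 (charVec_injective (vecWord_injective h))
  obtain ⟨hi, ⟨hnl, h1, -⟩ | ⟨hl, -, hi', -⟩⟩ := hi
  · obtain ⟨hj, ⟨-, h2, -⟩ | ⟨hl, -⟩⟩ := hj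
    · omega
    · exact absurd hl hnl
  · obtain ⟨hj, ⟨h2, -⟩ | ⟨-, -, hj', -⟩⟩ := hj
    · exact absurd hl h2
    · have h3 := h ⟨i, hi⟩
      have h4 := h ⟨j, hj⟩
      simp only [SolutionBit, hl, not_true_eq_false, false_and, true_and, false_or,
        Set.mem_ofPred_eq, sameCol_refl, false_iff, iff_false, not_not] at h3 h4
      rcases lt_trichotomy i j with hlt | he | hlt
      · exact absurd h3 (hj' i hlt)
      · exact he
      · exact absurd h4 (hi' j hlt)

namespace Tm

def lastBit (x : Tm) : Tm := letter 2 (plus (minus len dim) x)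
def lastOne : Tm := all 4 dim (lastBit (var 4))
def oneCol (x : Tm) : Tm := allRows (minus len dim) (cell x)
def sameCol (x y : Tm) : Tm := allRows (minus len dim) (iff (cell x) (cell y))

def chosen : Tm :=
  or (and (not lastOne) (and (eq (var 6) (const 0)) (ex 4 dim (lastBit (var 4)))))
    (and lastOne (and (not (oneCol (var 6))) (and (all 4 (var 6) (not (sameCol (var 6) (var 4))))
      (ex 4 dim (not (sameCol (var 6) (var 4)))))))

def solutionBit : Tm :=
  or (and (not lastOne) (lastBit (var 5))) (and lastOne (not (sameCol (var 6) (var 5))))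

variable {w : Word} {e : ℕ → ℕ}

theorem holds_lastBit {x : Tm} (he : e 0 = w.length) :
    (lastBit x).Holds w e ↔ LastBit w (x.eval w e) := by
  simp [lastBit, LastBit, eval_dim he, eval_len he]

theorem holds_lastOne (he : e 0 = w.length) : lastOne.Holds w e ↔ LastOne w := by
  have h4 : ∀ i, Function.update e 4 i 0 = w.length := by simp [he]
  simp [lastOne, LastOne, eval_dim he, holds_lastBit (h4 _)]

theorem holds_oneCol {v : ℕ} (hv : v ≠ 3) (he : e 0 = w.length) :
    (oneCol (var v)).Holds w e ↔ OneCol w (e v) := by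
  have h3 : ∀ r, Function.update e 3 r 0 = w.length := by simp [he]
  rw [oneCol, holds_allRows he (Nat.sub_le _ (dimOf w))
    fun e he => by simp [eval_dim he, eval_len he], OneCol]
  simp [holds_cell (h3 _), Function.update_of_ne hv]

theorem holds_sameCol {u v : ℕ} (hu : u ≠ 3) (hv : v ≠ 3) (he : e 0 = w.length) :
    (sameCol (var u) (var v)).Holds w e ↔ SameCol w (e u) (e v) := by
  have h3 : ∀ r, Function.update e 3 r 0 = w.length := by simp [he]
  rw [sameCol, holds_allRows he (Nat.sub_le _ (dimOf w))
    fun e he => by simp [eval_dim he, eval_len he], SameCol]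
  simp [holds_cell (h3 _), Function.update_of_ne hu, Function.update_of_ne hv]

theorem holds_chosen (he : e 0 = w.length) : chosen.Holds w e ↔ Chosen w (e 6) := by
  have h4 : ∀ i, Function.update e 4 i 0 = w.length := by simp [he]
  simp [chosen, Chosen, holds_lastOne he, holds_oneCol, he, holds_lastBit (h4 _), eval_dim he,
    holds_sameCol _ _ (h4 _)]

theorem holds_solutionBit (he : e 0 = w.length) :
    solutionBit.Holds w e ↔ SolutionBit w (e 6) (e 5) := by
  simp [solutionBit, SolutionBit, holds_lastOne he, holds_lastBit he, holds_sameCol _ _ he]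

end Tm

theorem delayP_closureSolutions : DelayP fun w => {y | y ∈ closureSolutions w} := by
  refine Tm.delayP (sum 6 dim (cond chosen (seq (writeVec solutionBit) emit))) _ ?_
    nodup_closureSolutions
  intro w
  have h6 : ∀ i, Function.update (env₀ w) 6 i 0 = w.length := by simp [env₀]
  have h5 : ∀ i j, Function.update (Function.update (env₀ w) 6 i) 5 j 0 = w.length := by
    simp [env₀]
  have hc : chosen.isPure = true := rfl
  have hs : solutionBit.isPure = true := rfl
  simp only [ops_sum, ops_of_isPure isPure_dim, List.nil_append, eval_dim (env₀_zero w),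
    ops_cond _ _ _ _ hc, ops_seq, ops_emit, ops_writeVec (h6 _) hs, flatMap_ite, outputs,
    closureSolutions, List.flatMap_map]
  congr!
  · rw [holds_solutionBit (h5 _ _)]
    simp
  · rw [holds_chosen (h6 _), Function.update_self]

/-! ### From independent sets to closures -/

/-- Two more coordinates, a constant `1` and a constant `0`. -/
def extend (v : Fin n → Bool) : Fin (n + 2) → Bool :=
  Fin.cons (n := n + 1) (α := fun _ => Bool) true (Fin.cons (α := fun _ => Bool) false v)

noncomputable def indVectors (k n : ℕ) (w : Word) : List (Fin (n + 2) → Bool) :=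
  ((tuples n k (env₀ w)).filter fun e => (rowFree k).Holds w e).map fun e =>
    extend (charVec (tupleSet k n e))

/-- The map from hypergraphs to families of vectors. -/
noncomputable def toFamily (k : ℕ) (w : Word) : Word :=
  -- Hypergraphs of dimension above `k` have no solutions, so the dimension must be tested here as
  -- well.
  if (Tm.and valid (smallRows k)).Holds w (env₀ w) then
    familyWord (dimOf w + 2) (indVectors k (dimOf w) w)
  else []

theorem vecWord_true_add_two (n : ℕ) :
    vecWord (fun _ : Fin (n + 2) => true) = [.one, .one] ++ vecWord (fun _ : Fin n => true) := by
  simp [vecWord, List.ofFn_succ]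

theorem vecWord_extend (v : Fin n → Bool) : vecWord (extend v) = [.one, .zero] ++ vecWord v := by
  rw [extend, vecWord_cons, vecWord_cons]
  rfl

theorem polyTime_toFamily (k : ℕ) : PolyTime (toFamily k) := by
  refine Tm.polyTime (seq (cond (Tm.and valid (smallRows k)) (family (seq (write .one) (write .one))
    (seq (write .one) (write .zero)) k (rowFree k))) emit) _ ?_
  intro w
  have hp : (Tm.and valid (smallRows k)).isPure = true := rfl
  rw [ops_seq, ops_cond _ _ _ _ hp, ops_family (hw := [.one, .one]) (bw := [.one, .zero])
    (env₀_zero w) (fun _ => rfl) (fun _ => rfl) (isPure_rowFree k), toFamily]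
  simp only [ops_emit, outputs, List.flatMap_cons, List.flatMap_nil, List.append_nil]
  split_ifs
  · rw [familyWord_eq, rows, indVectors]
    simp only [List.flatMap_cons, List.flatMap_map, vecWord_true_add_two, vecWord_extend,
      List.append_assoc]
  · rfl

/-- The last `dimOf w` letters of `w`. -/
noncomputable def lastVector (w : Word) : Word :=
  vecWord (charVec {i : Fin (dimOf w) | LastBit w i})

theorem delayP_lastVector : DelayP fun w => {y | y ∈ [lastVector w]} := by
  refine Tm.delayP (seq (writeVec (lastBit (var 5))) emit) _ ?_ (fun _ => List.nodup_singleton _)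
  intro w
  have h5 : ∀ i, Function.update (env₀ w) 5 i 0 = w.length := by simp [env₀]
  rw [ops_seq, ops_writeVec (env₀_zero w) rfl]
  simp only [ops_emit, outputs, List.flatMap_cons, List.flatMap_nil, List.append_nil, lastVector]
  congr!
  rw [holds_lastBit (h5 _), eval_var, Function.update_self]

end EnumRed

namespace EnumRed

open Tm

variable {k n : ℕ}

/-! ### Correctness of the first reduction -/

section First

variable {L : List (Fin n → Bool)} {v : Fin n → Bool} {w : Word}

theorem length_sub_dimOf (hw : w = familyWord n L ++ vecWord v) :
    w.length - dimOf w = (familyWord n L).length := by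
  rw [dimOf_eq hw, hw, List.length_append, length_vecWord, Nat.add_sub_cancel]

theorem lastBit_iff (hw : w = familyWord n L ++ vecWord v) (i : Fin n) :
    LastBit w i ↔ v i = true := by
  rw [LastBit, length_sub_dimOf hw, inputAt_append_vecWord hw]

theorem lastOne_iff (hw : w = familyWord n L ++ vecWord v) : LastOne w ↔ ∀ i, v i = true := by
  rw [LastOne, dimOf_eq hw]
  exact ⟨fun h i => (lastBit_iff hw i).1 (h i i.2), fun h i hi => (lastBit_iff hw ⟨i, hi⟩).2 (h _)⟩

theorem sameCol_iff (hw : w = familyWord n L ++ vecWord v) (i j : Fin n) :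
    SameCol w i j ↔ Twins {v | v ∈ L} i j := by
  rw [SameCol, length_sub_dimOf hw, forall_rows hw fun f => (f i ↔ f j)]
  refine forall₂_congr fun u _ => ?_
  rw [Bool.eq_iff_iff]

theorem oneCol_iff (hw : w = familyWord n L ++ vecWord v) (i : Fin n) :
    OneCol w i ↔ IsOne {v | v ∈ L} i := by
  rw [OneCol, length_sub_dimOf hw, forall_rows hw fun f => f i]
  rfl

theorem mem_closureSolutions (hw : w = familyWord n L ++ vecWord v) {y : Word} :
    y ∈ closureSolutions w ↔ ∃ i : Fin n, Chosen w i ∧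
      y = vecWord (charVec {j : Fin n | SolutionBit w i j}) := by
  have hd := dimOf_eq hw
  rw [closureSolutions]
  generalize dimOf w = m at hd
  subst hd
  simp only [List.mem_map, List.mem_filter, List.mem_range, decide_eq_true_eq]
  constructor
  · rintro ⟨i, ⟨hi, hc⟩, rfl⟩
    exact ⟨⟨i, hi⟩, hc, rfl⟩
  · rintro ⟨i, hc, rfl⟩
    exact ⟨i, ⟨i.2, hc⟩, rfl⟩

theorem closureSolutions_of_ne (hw : w = familyWord n L ++ vecWord v) (hv : ¬ ∀ i, v i = true)
    {y : Word} : y ∈ closureSolutions w ↔ (∃ i, v i = true) ∧ y = vecWord v := by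
  rw [mem_closureSolutions hw]
  have h1 : ¬ LastOne w := by rwa [lastOne_iff hw]
  simp only [Chosen, SolutionBit, h1, not_false_eq_true, true_and, false_and, or_false,
    lastBit_iff hw, dimOf_eq hw]
  have h2 : (∃ j < n, LastBit w j) ↔ ∃ i, v i = true :=
    ⟨fun ⟨j, hj, h⟩ => ⟨⟨j, hj⟩, (lastBit_iff hw ⟨j, hj⟩).1 h⟩,
      fun ⟨i, h⟩ => ⟨i, i.2, (lastBit_iff hw i).2 h⟩⟩
  rw [h2]
  rw [charVec_setOf]
  constructor
  · rintro ⟨i, ⟨-, h⟩, hy⟩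
    exact ⟨h, hy⟩
  · rintro ⟨⟨i, h⟩, hy⟩
    exact ⟨⟨0, by have := i.2; omega⟩, ⟨rfl, i, h⟩, hy⟩

theorem closureSolutions_of_eq (hw : w = familyWord n L ++ vecWord v) (hv : ∀ i, v i = true)
    {y : Word} : y ∈ closureSolutions w ↔ ∃ i, ¬ IsOne {v | v ∈ L} i ∧
      (∀ j < i, ¬ Twins {v | v ∈ L} i j) ∧ (∃ j, ¬ Twins {v | v ∈ L} i j) ∧
        y = vecWord (charVec {j | ¬ Twins {v | v ∈ L} i j}) := by
  rw [mem_closureSolutions hw]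
  have h1 : LastOne w := by rwa [lastOne_iff hw]
  simp only [Chosen, SolutionBit, h1, not_true_eq_false, true_and, false_and, false_or,
    oneCol_iff hw, sameCol_iff hw, dimOf_eq hw, and_assoc]
  refine exists_congr fun i => and_congr_right fun _ => and_congr ?_ (and_congr ?_ Iff.rfl)
  · exact ⟨fun h j hj hs => h j hj ((sameCol_iff hw i j).2 hs),
      fun h j hj hs => h ⟨j, by omega⟩ hj ((sameCol_iff hw i ⟨j, by omega⟩).1 hs)⟩
  · exact ⟨fun ⟨j, hj, h⟩ => ⟨⟨j, hj⟩, fun hs => h ((sameCol_iff hw i ⟨j, hj⟩).2 hs)⟩,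
      fun ⟨j, h⟩ => ⟨j, j.2, fun hs => h ((sameCol_iff hw i j).1 hs)⟩⟩

end First

theorem dimension_coHypergraph_le (S : Set (Fin n → Bool)) : dimension (coHypergraph k S) ≤ k :=
  dimension_le.2 fun _ he => he.1

theorem maximal_indep_eq_univ {H : Hypergraph (Fin n)} (h : Indep H Set.univ) {T : Set (Fin n)} :
    Maximal (Indep H) T ↔ T = Set.univ := by
  constructor
  · intro hT
    exact hT.eq_of_le h (Set.subset_univ _)
  · rintro rfl
    exact ⟨h, fun _ _ _ => Set.subset_univ _⟩

theorem closureMax_reduces (hk : 1 ≤ k) :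
    PolyDelayReduces (EnumClosureMax (S12 k)) (EnumKMaxIndSet k) := by
  refine ⟨toHypergraph k, polyTime_toHypergraph k, _, delayP_closureSolutions, fun x => ?_⟩
  by_cases hx : ∃ (n : ℕ) (L : List (Fin n → Bool)), x = familyWord n L
  swap
  · have h0 : toHypergraph k x = [] := by
      rw [toHypergraph, if_neg]
      rwa [holds_valid rfl]
    rw [h0, enumKMaxIndSet_eq_empty nil_not_familyWord, enumClosureMax_eq_empty hx]
    simp
  obtain ⟨n, L, rfl⟩ := hx
  rw [enumKMaxIndSet_eq (toHypergraph_familyWord k L), enumClosureMax_familyWord]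
  simp only [dimension_coHypergraph_le, true_and]
  by_cases hu : Indep (coHypergraph k {v | v ∈ L}) Set.univ
  -- The hypergraph has the single solution `1`, from which all maximal vectors are produced, so
  -- disjointness is vacuous.
  · simp only [maximal_indep_eq_univ hu, exists_eq_left, Set.mem_ofPred_eq]
    refine ⟨fun y hy z hz hne => absurd (hy.trans hz.symm) hne, ?_⟩
    ext y
    simp only [Set.mem_ofPred_eq, Set.mem_iUnion, exists_prop, exists_eq_left]
    rw [closureSolutions_of_eq rfl (by simp)]
    simp only [maximal_cl_diff_of_indep hk hu]
    constructor
    · rintro ⟨v, ⟨i, h1, h2, h3, rfl⟩, rfl⟩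
      exact ⟨i, h1, h2, h3, rfl⟩
    · rintro ⟨i, h1, h2, h3, rfl⟩
      exact ⟨_, ⟨i, h1, h2, h3, rfl⟩, rfl⟩
  -- No solution is the vector `1`, so each one yields itself, or nothing if it is the zero vector.
  · have hne : ∀ T, Maximal (Indep (coHypergraph k {v | v ∈ L})) T →
        ¬ ∀ i, charVec T i = true := by
      intro T hT h
      refine hu ?_
      have : T = Set.univ := by
        ext i
        simpa using h i
      exact this ▸ hT.prop
    constructor
    · rintro y ⟨T, hT, rfl⟩ z ⟨T', hT', rfl⟩ hyz
      ext a
      simp only [Set.mem_inter_iff, Set.mem_ofPred_eq, Set.mem_empty_iff_false, iff_false,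
        closureSolutions_of_ne rfl (hne T hT), closureSolutions_of_ne rfl (hne T' hT')]
      rintro ⟨⟨-, rfl⟩, -, h⟩
      exact hyz h
    · ext y
      simp only [Set.mem_ofPred_eq, Set.mem_iUnion, exists_prop, maximal_cl_diff hk hu]
      constructor
      · rintro ⟨v, ⟨h1, h2⟩, rfl⟩
        refine ⟨_, ⟨_, h1, rfl⟩, ?_⟩
        rw [closureSolutions_of_ne rfl (hne _ h1), charVec_setOf]
        exact ⟨h2, rfl⟩
      · rintro ⟨_, ⟨T, hT, rfl⟩, h⟩
        rw [closureSolutions_of_ne rfl (hne T hT)] at h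
        exact ⟨charVec T, ⟨by simpa using hT, h.1⟩, h.2⟩

/-! ### Correctness of the second reduction -/

@[simp] theorem extend_zero (v : Fin n → Bool) : extend v 0 = true := rfl

@[simp] theorem extend_one (v : Fin n → Bool) : extend v 1 = false := rfl

@[simp] theorem extend_succ_succ (v : Fin n → Bool) (i : Fin n) : extend v i.succ.succ = v i := rfl

theorem forall_fin_add_two {P : Fin (n + 2) → Prop} :
    (∀ i, P i) ↔ P 0 ∧ P 1 ∧ ∀ i : Fin n, P i.succ.succ := by
  rw [Fin.forall_fin_succ, Fin.forall_fin_succ]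
  rfl

theorem le_extend {u : Fin (n + 2) → Bool} {v : Fin n → Bool} :
    u ≤ extend v ↔ u 1 = false ∧ ∀ i : Fin n, u i.succ.succ ≤ v i := by
  rw [Pi.le_def, forall_fin_add_two, extend_zero, extend_one]
  simp only [Bool.le_true, true_and, extend_succ_succ]
  refine and_congr_left fun _ => ?_
  cases u 1 <;> simp

/-- The extended characteristic vectors of the independent sets of at most `k` elements. -/
def indSet (k : ℕ) (H : Hypergraph (Fin n)) : Set (Fin (n + 2) → Bool) :=
  {u | ∃ I : Set (Fin n), I.ncard ≤ k ∧ Indep H I ∧ u = extend (charVec I)}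

/-- No independent set contains a hyperedge, so hyperedges stay uncovered, and their size is at most
`k`. Conversely, a small subset of an independent set is itself one of the sets of the family and
covers itself. Coordinate `1` is never covered, and coordinate `0` always is. -/
theorem indep_indSet (hk : 1 ≤ k) {H : Hypergraph (Fin n)} (hV : H.vertexSet = Set.univ)
    (hH : ∀ e ∈ H.edgeSet, e.ncard ≤ k) {T : Set (Fin (n + 2))} :
    Indep (coHypergraph k (indSet k H)) T ↔ 1 ∉ T ∧ Indep H {i | i.succ.succ ∈ T} := by
  have hinj : Function.Injective fun i : Fin n => i.succ.succ :=
    (Fin.succ_injective _).comp (Fin.succ_injective _)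
  rw [indep_coHypergraph]
  constructor
  · intro h
    constructor
    · intro h1
      obtain ⟨u, ⟨I, -, -, rfl⟩, hu⟩ := h {1} (by simpa using h1) (by simpa using hk)
      simpa using hu 1 rfl
    · refine ⟨by rw [hV]; exact Set.subset_univ _, fun e he hT => ?_⟩
      obtain ⟨u, ⟨I, -, hI, rfl⟩, hu⟩ := h ((fun i : Fin n => i.succ.succ) '' e)
        (by rintro _ ⟨i, hi, rfl⟩; exact hT hi)
        (by rw [Set.ncard_image_of_injective _ hinj]; exact hH e he)
      refine hI.2 e he fun i hi => ?_
      have := hu _ ⟨i, hi, rfl⟩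
      simpa using this
  · rintro ⟨h1, h2⟩ I hI hc
    refine ⟨_, ⟨{i | i.succ.succ ∈ I}, ?_, h2.mono fun i hi => hI hi, rfl⟩, ?_⟩
    · refine le_trans ?_ hc
      rw [← Set.ncard_image_of_injective _ hinj]
      refine Set.ncard_le_ncard ?_
      rintro _ ⟨i, hi, rfl⟩
      exact hi
    · rw [forall_fin_add_two]
      refine ⟨fun _ => rfl, fun h => absurd (hI h) h1, fun i hi => ?_⟩
      rw [extend_succ_succ, charVec_apply]
      exact hi

/-- The added coordinates are constant on the closure with different values, so excluding the two
constant vectors changes nothing, and maximal sets correspond by adding coordinate `0`. -/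
theorem maximal_cl_indSet (hk : 1 ≤ k) {H : Hypergraph (Fin n)} (hV : H.vertexSet = Set.univ)
    (hH : ∀ e ∈ H.edgeSet, e.ncard ≤ k) {v : Fin (n + 2) → Bool} :
    Maximal (fun u => u ∈ Cl (S12 k) (indSet k H) \ {(fun _ => false), (fun _ => true)}) v ↔
      ∃ T, Maximal (Indep H) T ∧ v = extend (charVec T) := by
  have key := @indep_indSet k n hk H hV hH
  have key' : ∀ v : Fin (n + 2) → Bool, Indep (coHypergraph k (indSet k H)) {i | v i = true} ↔
      v 1 = false ∧ Indep H {i | v i.succ.succ = true} := by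
    intro v
    rw [key]
    simp
  rw [maximal_cl_diff hk (by rw [key]; simp)]
  have hext : ∀ T : Set (Fin n), Indep H T →
      Indep (coHypergraph k (indSet k H)) {i | extend (charVec T) i = true} := by
    intro T hT
    rw [key']
    simpa using hT
  constructor
  · rintro ⟨h, -⟩
    obtain ⟨h1, h2⟩ := (key' v).1 h.prop
    have hle : ∀ T, {i | v i.succ.succ = true} ⊆ T → v ≤ extend (charVec T) := by
      intro T hT
      rw [le_extend]
      exact ⟨h1, fun i hi => charVec_apply.2 (hT hi)⟩
    have heq : ∀ T, Indep H T → {i | v i.succ.succ = true} ⊆ T → extend (charVec T) ≤ v :=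
      fun T hT hvT => h.le_of_ge (hext T hT) (hle T hvT)
    refine ⟨{i | v i.succ.succ = true}, ⟨h2, fun T hT hvT i hi => ?_⟩, ?_⟩
    · exact heq T hT hvT i.succ.succ (charVec_apply.2 hi)
    · exact le_antisymm (hle _ subset_rfl) (heq _ h2 subset_rfl)
  · rintro ⟨T, hT, rfl⟩
    refine ⟨⟨hext T hT.prop, fun U hU hle => ?_⟩, 0, rfl⟩
    obtain ⟨h1, h2⟩ := key.1 hU
    have h3 := hT.le_of_ge h2 fun i hi => hle (show extend (charVec T) i.succ.succ = true by simpa)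
    intro i
    revert i
    rw [forall_fin_add_two]
    exact ⟨fun _ => rfl, fun h => absurd h h1, fun i hi => charVec_apply.2 (h3 hi)⟩

theorem lastVector_extend {L : List (Fin n → Bool)} (v : Fin n → Bool) :
    lastVector (familyWord n L ++ vecWord (extend v)) = vecWord v := by
  have hd := dimOf_eq (w := familyWord n L ++ vecWord (extend v)) rfl
  have hb : ∀ i : Fin n, LastBit (familyWord n L ++ vecWord (extend v)) i ↔ v i = true := by
    intro i
    rw [LastBit, hd, ← extend_succ_succ v i, ← inputAt_append_vecWord (x := familyWord n L) rfl]
    rw [List.length_append, length_vecWord]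
    simp only [Fin.val_succ]
    rw [show (familyWord n L).length + (n + 2) - n + i = (familyWord n L).length + (i + 1 + 1) by
      omega]
  rw [lastVector]
  generalize familyWord n L ++ vecWord (extend v) = w at hd hb
  generalize dimOf w = m at hd
  subst hd
  congr 1
  ext i
  rw [Bool.eq_iff_iff, charVec_apply, Set.mem_ofPred_eq, hb]

theorem mem_indVectors {L : List (Fin n → Bool)} {u : Fin (n + 2) → Bool} :
    u ∈ indVectors k n (familyWord n L) ↔ u ∈ indSet k (hypergraphOf L) := by
  have hI : ∀ I : Set (Fin n), Indep (hypergraphOf L) I ↔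
      ∀ u ∈ L, ¬ ∀ i, u i = true → i ∈ I := by
    intro I
    constructor
    · intro h u hu hs
      exact h.2 {i | u i = true} (by simpa [hypergraphOf] using hu) hs
    · intro h
      refine ⟨Set.subset_univ _, fun e he hs => h _ he fun i hi => hs (charVec_apply.1 hi)⟩
  simp only [indVectors, indSet, List.mem_map, List.mem_filter, decide_eq_true_eq,
    Set.mem_ofPred_eq]
  constructor
  · rintro ⟨e, ⟨he, h⟩, rfl⟩
    rw [holds_rowFree rfl (apply_zero_of_mem_tuples he)] at h
    exact ⟨_, ncard_tupleSet_le _ _ _, (hI _).2 h, rfl⟩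
  · rintro ⟨I, hc, h, rfl⟩
    obtain ⟨e, he, rfl⟩ := exists_tupleSet (env₀ (familyWord n L)) hc
    refine ⟨e, ⟨he, ?_⟩, rfl⟩
    rw [holds_rowFree rfl (apply_zero_of_mem_tuples he)]
    exact (hI _).1 h

theorem indSet_reduces (hk : 1 ≤ k) :
    PolyDelayReduces (EnumKMaxIndSet k) (EnumClosureMax (S12 k)) := by
  refine ⟨toFamily k, polyTime_toFamily k, _, delayP_lastVector, fun x => ?_⟩
  by_cases hx : ∃ (n : ℕ) (L : List (Fin n → Bool)), x = familyWord n L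
  swap
  · have h0 : toFamily k x = [] := by
      rw [toFamily, if_neg]
      rw [holds_and, holds_valid rfl]
      exact fun h => hx h.1
    rw [h0, enumKMaxIndSet_eq_empty hx, enumClosureMax_eq_empty nil_not_familyWord]
    simp
  obtain ⟨n, L, rfl⟩ := hx
  rw [enumKMaxIndSet_eq (encodes_hypergraphOf L)]
  have hsmall : (∀ u ∈ L, {i | u i = true}.ncard ≤ k) ↔
      ∀ e ∈ (hypergraphOf L).edgeSet, e.ncard ≤ k := by
    constructor
    · intro h e he
      simpa using h _ he
    · intro h u hu
      exact h _ (by simpa [hypergraphOf] using hu)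
  have hcond : (Tm.and valid (smallRows k)).Holds (familyWord n L) (env₀ (familyWord n L)) ↔
      dimension (hypergraphOf L) ≤ k := by
    rw [holds_and, holds_valid rfl, holds_smallRows rfl rfl, hsmall, dimension_le,
      and_iff_right ⟨n, L, rfl⟩]
  by_cases hdim : dimension (hypergraphOf L) ≤ k
  swap
  · rw [toFamily, if_neg (by rwa [hcond]), enumClosureMax_eq_empty nil_not_familyWord]
    simp [hdim]
  rw [toFamily, if_pos (hcond.2 hdim), dimOf_eq (L := L) (y := []) (by simp),
    enumClosureMax_familyWord]
  have hS : {v | v ∈ indVectors k n (familyWord n L)} = indSet k (hypergraphOf L) := by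
    ext u
    exact mem_indVectors
  simp only [hS, maximal_cl_indSet hk (H := hypergraphOf L) rfl (dimension_le.1 hdim), hdim,
    true_and, List.mem_singleton]
  constructor
  -- All solutions agree on the two added coordinates, so deleting these is injective.
  · rintro y ⟨_, ⟨T, hT, rfl⟩, rfl⟩ z ⟨_, ⟨T', hT', rfl⟩, rfl⟩ hne
    ext a
    simp only [Set.mem_inter_iff, Set.mem_ofPred_eq, Set.mem_empty_iff_false, iff_false,
      lastVector_extend]
    rintro ⟨rfl, h⟩
    exact hne (congrArg (fun v => vecWord (extend v)) (vecWord_injective h))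
  · ext y
    simp only [Set.mem_ofPred_eq, Set.mem_iUnion, exists_prop]
    constructor
    · rintro ⟨T, hT, rfl⟩
      exact ⟨_, ⟨_, ⟨T, hT, rfl⟩, rfl⟩, (lastVector_extend _).symm⟩
    · rintro ⟨_, ⟨_, ⟨T, hT, rfl⟩, rfl⟩, h⟩
      exact ⟨T, hT, h.trans (lastVector_extend _)⟩

end EnumRed

open EnumRed

theorem mainTheorem4 (k : ℕ) (hk : 2 ≤ k) :
    PolyDelayEquiv (EnumClosureMax (S12 k)) (EnumKMaxIndSet k) ∧
    (∀ (n : ℕ) (S : Set (Fin n → Bool)),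
      (∀ i, ∃ u ∈ S, u i = false) →
      (∀ i j, i ≠ j → ∃ u ∈ S, u i ≠ u j) →
      Cl (S12 k) S = charVec '' {T | Indep (coHypergraph k S) T}) ∧
    (∀ (n : ℕ) (S : Set (Fin n → Bool)),
      {v | Maximal (fun u => u ∈ Cl (S12 k) S) v} =
        charVec '' {T | Maximal (Indep (coHypergraph k S)) T}) :=
  have hk' : 1 ≤ k := by omega
  ⟨⟨closureMax_reduces hk', indSet_reduces hk'⟩, fun _ _ => cl_eq_image_indep hk',
    fun _ _ => maximal_cl_eq_image hk'⟩
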